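/- **Second continuity theorem.** Let $F$ be a connected compact metric space and $M \ge 2$, and let $\psi_1,\dots,\psi_M : F \to F$ be injective strict contractions with $F=\bigcup_i \psi_i(F)$. For a finite word $w = w_1\cdots w_n$ over $I=\{1,\dots,M\}$ put $\psi_w=\psi_{w_1}\circ\cdots\circ\psi_{w_n}$; for an infinite word $\omega$ let $\pi(\omega)$ be the unique point of $\bigcap_n \psi_{\omega_1\cdots\omega_n}(F)$. Let $\sigma$ be the left shift on infinite words, and assume that the post-critical set $P=\bigcup_{n\ge1}\sigma^n\big(\pi^{-1}(\bigcup_{i\ne j}\psi_i(F)\cap\psi_j(F))\big)$ is finite. Put $F^0=\pi(P)$ and $F^m=\bigcup_{|w|=m}\psi_w(F^0)$. Let $(A_0,(r_i)_{i \in I})$ be a regular irreducible harmonic structure: $A_0$ is a real symmetric non-positive definite matrix indexed by $F^0$, with non-negative off-diagonal entries, whose kernel consists exactly of the constant functions; $r_i\in(0,1)$ for all $i$; and, with $\mathcal E_m(u,u)=-\sum_{|w|=m} r_w^{-1}\,(u\circ\psi_w|_{F^0})^{\top}A_0\,(u\circ\psi_w|_{F^0})$ and $r_w=r_{w_1}\cdots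 r_{w_m}$, for every $m\ge0$ and $u:F^m\to\mathbb R$ one has $\mathcal E_m(u,u)=\min\{\mathcal E_{m+1}(v,v): v:F^{m+1}\to\mathbb{R},\ v|_{F^m}=u\}$. Let $\mathcal E(f,f)=\lim_m\mathcal E_m(f|_{F^m},f|_{F^m})$ for $f \in C(F)$, let $\mathcal D=\{f\in C(F):\mathcal E(f,f)<\infty\}$, let $$R(x,y)=\big(\inf\{\mathcal E(f,f): f\in\mathcal D,\ f(x)=0,\ f(y)=1\}\big)^{-1}$$ be the resistance metric, and let $d_H>0$ be the unique number with $\sum_i r_i^{d_H}=1$. Let $(E,\Delta)$ be a complete separable metric space, let $T>0$ (for example $T=1$), and let $\xi=(\xi_{tx}:(t,x)\in[0,T]\times F)$ be an $E$-valued process on a probability space. Suppose that there are $C,\beta,\gamma,\gamma'>0$ such that $$\mathbb E[\Delta(\xi_{tx},\xi_{ty})^\beta]\le C\,R(x,y)^{d_H+1+\gamma},\qquad \mathbb E[\Delta(\xi_{sx},\xi_{tx})^\beta]\le C\,|s-t|^{d_H+1+\gamma'}$$ for all $s,t\in[0,T]$ and all $x,y\in F$. Then there exists a version $\hat\xi=(\hat\xi_{tx})$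 of $\xi$ (each $\hat\xi_{tx}$ is a random variable, and $\hat\xi_{tx}=\xi_{tx}$ almost surely for each $(t,x)$) such that: 1. almost surely, $(t,x)\mapsto\hat\xi_{tx}$ is essentially $\frac{\gamma\wedge\gamma'}{\beta}$-Hölder continuous with respect to $R_\infty((s,x),(t,y))=\max\{|s-t|,R(x,y)\}$; 2. for every $t\in[0,T]$, almost surely, $x\mapsto\hat\xi_{tx}$ is essentially $\frac{1+\gamma}{\beta}$-Hölder continuous with respect to $R$; 3. for every $x\in F$, almost surely, $t\mapsto\hat\xi_{tx}$ is essentially $\frac{d_H+\gamma'}{\beta}$-Hölder continuous with respect to the Euclidean metric. Here, for $\delta>0$, a map $f:(M_1,d_1)\to(M_2,d_2)$ is essentially $\delta$-Hölder continuous if it is continuous and for every $\eta\in(0,\delta)$ there is a constant $c_\eta$ with $d_2(f(p),f(q))\le c_\eta\, d_1(p,q)^\eta$ for all $p,q\in M_1$. -/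

import Mathlib

open MeasureTheory

namespace PCF

/-- A self-similar set: a space `F` which is the union of its images under `M ≥ 2` injective
strict contractions `ψ i`. (Compactness and connectedness of `F` are type-class hypotheses.) -/
structure SelfSimilarSet (M : ℕ) (F : Type*) [MetricSpace F] where
  ψ : Fin M → F → F
  two_le : 2 ≤ M
  injective : ∀ i, Function.Injective (ψ i)
  contracting : ∀ i, ∃ K : NNReal, ContractingWith K (ψ i)
  cover : ⋃ i, Set.range (ψ i) = Set.univ

namespace SelfSimilarSet

variable {M : ℕ} {F : Type*} [MetricSpace F]

/-- `ψ_w = ψ_{w₁} ∘ ⋯ ∘ ψ_{wₙ}` for a finite word `w = w₁ ⋯ wₙ`. -/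
def wordMap (S : SelfSimilarSet M F) : {n : ℕ} → (Fin n → Fin M) → F → F
  | 0, _ => id
  | _ + 1, w => S.ψ (w 0) ∘ S.wordMap (Fin.tail w)

theorem wordMap_succ_last (S : SelfSimilarSet M F) (n : ℕ) (w : Fin (n + 1) → Fin M) :
    S.wordMap w = S.wordMap (Fin.init w) ∘ S.ψ (w (Fin.last n)) := by
  induction n with
  | zero => rfl
  | succ n ih =>
    have h := ih (Fin.tail w)
    change S.ψ (w 0) ∘ S.wordMap (Fin.tail w) = _
    rw [h]
    rfl

/-- The prefix of length `n` of an infinite word. -/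
def wordPrefix (ω : ℕ → Fin M) (n : ℕ) : Fin n → Fin M := fun k => ω k

theorem exists_ratio (S : SelfSimilarSet M F) :
    ∃ K : NNReal, K < 1 ∧ ∀ i, LipschitzWith K (S.ψ i) := by
  choose K hK using S.contracting
  refine ⟨Finset.univ.sup K, ?_, fun i => (hK i).2.weaken (Finset.le_sup (Finset.mem_univ i))⟩
  rw [Finset.sup_lt_iff (by simp)]
  exact fun i _ => (hK i).1

theorem lipschitzWith_wordMap (S : SelfSimilarSet M F) {K : NNReal}
    (hK : ∀ i, LipschitzWith K (S.ψ i)) (n : ℕ) (w : Fin n → Fin M) :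
    LipschitzWith (K ^ n) (S.wordMap w) := by
  induction n with
  | zero => simpa [wordMap] using LipschitzWith.id
  | succ n ih =>
    rw [pow_succ']
    exact (hK (w 0)).comp (ih (Fin.tail w))

/-- An infinite word determines exactly one point of `F`. -/
theorem exists_unique_point [CompactSpace F] [Nonempty F] (S : SelfSimilarSet M F)
    (ω : ℕ → Fin M) : ∃! x : F, ∀ n, x ∈ Set.range (S.wordMap (wordPrefix ω n)) := by
  obtain ⟨K, hK1, hK⟩ := S.exists_ratio
  have hL := fun n => S.lipschitzWith_wordMap hK n (wordPrefix ω n)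
  have hcpt : ∀ n, IsCompact (Set.range (S.wordMap (wordPrefix ω n))) :=
    fun n => isCompact_range (hL n).continuous
  have hne := IsCompact.nonempty_iInter_of_sequence_nonempty_isCompact_isClosed
    (fun n => Set.range (S.wordMap (wordPrefix ω n)))
    (fun n => by
      rintro _ ⟨y, rfl⟩
      rw [S.wordMap_succ_last]
      exact ⟨_, rfl⟩)
    (fun n => Set.range_nonempty _) (hcpt 0) (fun n => (hcpt n).isClosed)
  obtain ⟨x, hx⟩ := hne
  rw [Set.mem_iInter] at hx
  refine ⟨x, hx, fun y hy => ?_⟩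
  have hb : ∀ n : ℕ, dist y x ≤ (K : ℝ) ^ n * Metric.diam (Set.univ : Set F) := by
    intro n
    obtain ⟨a, ha⟩ := hy n
    obtain ⟨b, hb⟩ := hx n
    rw [← ha, ← hb]
    refine ((hL n).dist_le_mul a b).trans ?_
    push_cast
    gcongr
    exact Metric.dist_le_diam_of_mem isCompact_univ.isBounded (Set.mem_univ _) (Set.mem_univ _)
  have ht : Filter.Tendsto (fun n : ℕ => (K : ℝ) ^ n * Metric.diam (Set.univ : Set F))
      Filter.atTop (nhds (0 * Metric.diam (Set.univ : Set F))) :=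
    (tendsto_pow_atTop_nhds_zero_of_lt_one K.2 (by exact_mod_cast hK1)).mul_const _
  rw [zero_mul] at ht
  exact dist_le_zero.1 (ge_of_tendsto' ht hb)

/-- The canonical surjection `π` from infinite words to `F`:
`π ω` is the unique point of `⋂ₙ ψ_{ω₁ ⋯ ωₙ}(F)`. -/
noncomputable def proj [CompactSpace F] [Nonempty F] (S : SelfSimilarSet M F)
    (ω : ℕ → Fin M) : F := (S.exists_unique_point ω).choose

theorem proj_mem [CompactSpace F] [Nonempty F] (S : SelfSimilarSet M F)
    (ω : ℕ → Fin M) (n : ℕ) : S.proj ω ∈ Set.range (S.wordMap (wordPrefix ω n)) :=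
  (S.exists_unique_point ω).choose_spec.1 n

theorem eq_proj [CompactSpace F] [Nonempty F] (S : SelfSimilarSet M F)
    (ω : ℕ → Fin M) (x : F) (hx : ∀ n, x ∈ Set.range (S.wordMap (wordPrefix ω n))) :
    x = S.proj ω :=
  (S.exists_unique_point ω).choose_spec.2 x hx

/-- The union of all overlaps `ψ_i(F) ∩ ψ_j(F)`, `i ≠ j`. -/
def overlap (S : SelfSimilarSet M F) : Set F :=
  {x | ∃ i j, i ≠ j ∧ x ∈ Set.range (S.ψ i) ∩ Set.range (S.ψ j)}

/-- The post-critical set `⋃_{n ≥ 1} σⁿ(π⁻¹(overlap))`, where `σ` is the left shift on infinite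
words. -/
def postCritical [CompactSpace F] [Nonempty F] (S : SelfSimilarSet M F) : Set (ℕ → Fin M) :=
  {ω | ∃ n, 1 ≤ n ∧ ∃ τ : ℕ → Fin M, S.proj τ ∈ S.overlap ∧ ω = fun k => τ (k + n)}

/-- The boundary `F⁰ = π(P)`, where `P` is the post-critical set. -/
def boundary [CompactSpace F] [Nonempty F] (S : SelfSimilarSet M F) : Set F :=
  S.proj '' S.postCritical

/-- `Fⁿ = ⋃_{|w| = n} ψ_w(F⁰)`. -/
def vertices [CompactSpace F] [Nonempty F] (S : SelfSimilarSet M F) (n : ℕ) : Set F :=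
  ⋃ w : Fin n → Fin M, S.wordMap w '' S.boundary

end SelfSimilarSet

/-- A post-critically finite self-similar set. -/
structure PCFSet (M : ℕ) (F : Type*) [MetricSpace F] [CompactSpace F] [Nonempty F]
    extends SelfSimilarSet M F where
  finite_postCritical : toSelfSimilarSet.postCritical.Finite

section Harmonic

variable {M : ℕ} {F : Type*} [MetricSpace F] [CompactSpace F] [Nonempty F]

noncomputable instance (S : PCFSet M F) : Fintype S.boundary :=
  (S.finite_postCritical.image S.proj).fintype

/-- The form `ℰ₀(u,u) = -uᵀ A u` of a matrix `A` indexed by the boundary. -/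
noncomputable def boundaryEnergy (S : PCFSet M F) (A : Matrix S.boundary S.boundary ℝ)
    (u : S.boundary → ℝ) : ℝ := -(u ⬝ᵥ A.mulVec u)

/-- The form `ℰ_m(u,u) = ∑_{|w| = m} r_w⁻¹ ℰ₀(u ∘ ψ_w, u ∘ ψ_w)`, where `r_w = r_{w₁} ⋯ r_{w_m}`.
It depends only on the restriction of `u` to `F^m`. -/
noncomputable def levelEnergy (S : PCFSet M F) (A : Matrix S.boundary S.boundary ℝ)
    (r : Fin M → ℝ) (m : ℕ) (u : F → ℝ) : ℝ :=
  ∑ w : Fin m → Fin M,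
    (∏ k, r (w k))⁻¹ * boundaryEnergy S A (fun p => u (S.wordMap w (p : F)))

/-- A regular irreducible harmonic structure `(A, r)`: `A` is a Laplacian matrix on `F⁰`
(symmetric, non-positive definite, with kernel the constants, non-negative off the diagonal),
`r_i ∈ (0,1)`, and the sequence of forms `ℰ_m` on `F^m` is compatible, that is, `ℰ_m(u,u)` is the
minimum of `ℰ_{m+1}(v,v)` over the extensions `v` of `u|_{F^m}`. -/
structure RegularHarmonicStructure (S : PCFSet M F) where
  A : Matrix S.boundary S.boundary ℝ
  r : Fin M → ℝ
  symm : A.IsSymm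
  nonpos : ∀ u : S.boundary → ℝ, u ⬝ᵥ A.mulVec u ≤ 0
  ker_eq : ∀ u : S.boundary → ℝ, A.mulVec u = 0 ↔ ∃ c : ℝ, ∀ p, u p = c
  offDiag_nonneg : ∀ p q, p ≠ q → 0 ≤ A p q
  r_pos : ∀ i, 0 < r i
  r_lt_one : ∀ i, r i < 1
  compatible : ∀ (m : ℕ) (u : F → ℝ),
    IsLeast {e : ℝ | ∃ v : F → ℝ, (∀ x ∈ S.vertices m, v x = u x) ∧ levelEnergy S A r (m + 1) v = e}
      (levelEnergy S A r m u)

namespace RegularHarmonicStructure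

variable {S : PCFSet M F}

theorem exists_unique_dim (H : RegularHarmonicStructure S) :
    ∃! d : ℝ, 0 < d ∧ ∑ i, H.r i ^ d = 1 := by
  have hM := S.two_le
  have : Nonempty (Fin M) := ⟨⟨0, by omega⟩⟩
  have hcont : Continuous (fun d : ℝ => ∑ i, H.r i ^ d) :=
    continuous_finsetSum _ fun i _ => Real.continuous_const_rpow (H.r_pos i).ne'
  have hanti : StrictAnti (fun d : ℝ => ∑ i, H.r i ^ d) := fun a b hab =>
    Finset.sum_lt_sum_of_nonempty Finset.univ_nonempty fun i _ =>
      Real.rpow_lt_rpow_of_exponent_gt (H.r_pos i) (H.r_lt_one i) hab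
  have h0 : (1 : ℝ) < ∑ i, H.r i ^ (0 : ℝ) := by
    simp only [Real.rpow_zero, Finset.sum_const, Finset.card_univ, Fintype.card_fin, nsmul_eq_mul,
      mul_one]
    exact_mod_cast hM
  have hlim : Filter.Tendsto (fun d : ℝ => ∑ i, H.r i ^ d) Filter.atTop (nhds 0) := by
    have := tendsto_finsetSum (Finset.univ : Finset (Fin M)) (fun i _ =>
      tendsto_rpow_atTop_of_base_lt_one (H.r i) (by linarith [H.r_pos i]) (H.r_lt_one i))
    simpa using this
  obtain ⟨b, hb, hb0⟩ :=
    ((hlim.eventually (gt_mem_nhds (zero_lt_one (α := ℝ)))).and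
      (Filter.eventually_gt_atTop 0)).exists
  obtain ⟨d, hd, hd1⟩ := intermediate_value_Icc' hb0.le hcont.continuousOn ⟨hb.le, h0.le⟩
  refine ⟨d, ⟨lt_of_le_of_ne hd.1 ?_, hd1⟩, fun e he => hanti.injective (he.2.trans hd1.symm)⟩
  rintro rfl
  exact h0.ne' hd1

/-- The Hausdorff dimension `d_H` of `F` for the resistance metric: the unique `d > 0` with
`∑ r_i ^ d = 1`. -/
noncomputable def dimH (H : RegularHarmonicStructure S) : ℝ := H.exists_unique_dim.choose

theorem dimH_spec (H : RegularHarmonicStructure S) :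
    0 < H.dimH ∧ ∑ i, H.r i ^ H.dimH = 1 := H.exists_unique_dim.choose_spec.1

/-- `ℰ(f,f) = lim_m ℰ_m(f,f)` (a non-decreasing limit), with values in `[0,∞]`. The domain of the
Dirichlet form consists of the continuous `f` for which it is finite. -/
noncomputable def energy (H : RegularHarmonicStructure S) (f : C(F, ℝ)) : ENNReal :=
  ⨆ m : ℕ, ENNReal.ofReal (levelEnergy S H.A H.r m f)

/-- The domain of the Dirichlet form. -/
def domain (H : RegularHarmonicStructure S) : Set C(F, ℝ) := {f | H.energy f < ⊤}

/-- The resistance metric `R(x,y) = (inf {ℰ(f,f) : f ∈ 𝒟, f(x) = 0, f(y) = 1})⁻¹`; the infimum over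
the empty set is `∞`, so that `R(x,x) = 0`. -/
noncomputable def R (H : RegularHarmonicStructure S) (x y : F) : ℝ :=
  (⨅ f ∈ {f : C(F, ℝ) | f ∈ H.domain ∧ f x = 0 ∧ f y = 1}, H.energy f)⁻¹.toReal

/-- The metric `R_∞((s,x),(t,y)) = max {|s - t|, R(x,y)}` on `[0,T] × F`. -/
noncomputable def Rinf (H : RegularHarmonicStructure S) (T : ℝ)
    (p q : Set.Icc (0 : ℝ) T × F) : ℝ :=
  max |(p.1 : ℝ) - (q.1 : ℝ)| (H.R p.2 q.2)

end RegularHarmonicStructure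

end Harmonic

/-- `f` is continuous and `η`-Hölder continuous for every `η ∈ (0,δ)`, with respect to the
distance function `d` on its domain. -/
def EssentiallyHolder {X Y : Type*} [MetricSpace Y] (d : X → X → ℝ) (δ : ℝ) (f : X → Y) : Prop :=
  (∀ x, ∀ ε > 0, ∃ η > 0, ∀ y, d x y < η → dist (f x) (f y) < ε) ∧
    ∀ η, 0 < η → η < δ → ∃ c : ℝ, ∀ x y, dist (f x) (f y) ≤ c * d x y ^ η

end PCF

/-!
The theorem is a Kolmogorov–Chentsov continuity theorem on `[0,T] × F`. If a space is covered by
`O(δ ^ (-κ))` balls of radius `δ` and the `p`-th moments of the increments are at most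
`C * dist ^ q` with `κ < q`, chaining along nets of mesh `2⁻ⁿ` gives a modification that is
`η`-Hölder for every `η < (q - κ) / p`.

The covering exponent of `F` for `R` is `d_H`. Indeed `(f x - f y) ^ 2 ≤ R x y * ℰ(f,f)` for every
`f` in the domain, so `√R` is a pseudo-metric, and `ψ_i` contracts `R` by the factor `r_i`, because
`ℰ(f ∘ ψ_i, f ∘ ψ_i) ≤ r_i * ℰ(f,f)`. Covering `F` by its cells of `R`-diameter about `δ` and using
`∑ r_i ^ d_H = 1` bounds their number. That `R` is bounded comes from the irreducibility of `A_0`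
and the connectedness of `F`.

On the product the covering exponent is `d_H + 1`, which leaves `(γ ∧ γ') / β` for the joint
modification. Its sections in `x` and in `t` are continuous modifications of processes on spaces of
covering exponent `d_H` and `1`, hence have the larger exponents `(1 + γ) / β` and
`(d_H + γ') / β`.
-/

namespace PCF

open Filter Topology ProbabilityTheory ENNReal NNReal

section Covering

variable {X Y ι : Type*} {d : X → X → ℝ} {e : Y → Y → ℝ}

/-- At most `N` balls of radius `δ` cover the space. Mathlib's covering numbers need a
pseudo-emetric space, whereas here `d` is an arbitrary function, since the resistance metric is only
known to be the square of a pseudo-metric. -/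
def CoveringNumberLE (d : X → X → ℝ) (δ N : ℝ) : Prop :=
  ∃ J : Finset X, (J.card : ℝ) ≤ N ∧ ∀ x, ∃ y ∈ J, d x y ≤ δ

/-- The covering number at scale `δ` is `O(δ ^ (-κ))`, that is, `κ` bounds the upper Minkowski
dimension of the space. -/
def HasCoveringExponent (d : X → X → ℝ) (κ : ℝ) : Prop :=
  ∃ A : ℝ, ∀ δ : ℝ, 0 < δ → δ ≤ 1 → CoveringNumberLE d δ (A * δ ^ (-κ))

theorem CoveringNumberLE.mono {δ N N' : ℝ} (h : CoveringNumberLE d δ N) (hN : N ≤ N') :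
    CoveringNumberLE d δ N' :=
  let ⟨J, hJ, hcov⟩ := h
  ⟨J, hJ.trans hN, hcov⟩

theorem CoveringNumberLE.nonneg {δ N : ℝ} (h : CoveringNumberLE d δ N) : 0 ≤ N :=
  let ⟨J, hJ, _⟩ := h
  J.card.cast_nonneg.trans hJ

theorem coveringNumberLE_of_forall_le [Nonempty X] {δ N : ℝ} (hd : ∀ x y, d x y ≤ δ)
    (hN : 1 ≤ N) : CoveringNumberLE d δ N :=
  let ⟨x₀⟩ := ‹Nonempty X›
  ⟨{x₀}, by simpa using hN, fun x => ⟨x₀, Finset.mem_singleton_self x₀, hd x x₀⟩⟩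

theorem CoveringNumberLE.prod {δ N N' : ℝ} (hd : CoveringNumberLE d δ N)
    (he : CoveringNumberLE e δ N') :
    CoveringNumberLE (fun p q : X × Y => max (d p.1 q.1) (e p.2 q.2)) δ (N * N') := by
  have hN := hd.nonneg
  obtain ⟨J, hJ, hJd⟩ := hd
  obtain ⟨K, hK, hKe⟩ := he
  refine ⟨J ×ˢ K, ?_, fun p => ?_⟩
  · rw [Finset.card_product, Nat.cast_mul]
    gcongr
  · obtain ⟨y, hy, hpy⟩ := hJd p.1
    obtain ⟨z, hz, hpz⟩ := hKe p.2
    exact ⟨(y, z), Finset.mk_mem_product hy hz, max_le hpy hpz⟩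

theorem HasCoveringExponent.prod {κ μ : ℝ} (hd : HasCoveringExponent d κ)
    (he : HasCoveringExponent e μ) :
    HasCoveringExponent (fun p q : X × Y => max (d p.1 q.1) (e p.2 q.2)) (κ + μ) := by
  obtain ⟨A, hA⟩ := hd
  obtain ⟨B, hB⟩ := he
  refine ⟨A * B, fun δ h0 h1 => ((hA δ h0 h1).prod (hB δ h0 h1)).mono (le_of_eq ?_)⟩
  rw [neg_add, Real.rpow_add h0]
  ring

theorem HasCoveringExponent.sqrt {κ : ℝ} (h : HasCoveringExponent d κ) :
    HasCoveringExponent (fun x y => √(d x y)) (2 * κ) := by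
  obtain ⟨A, hA⟩ := h
  refine ⟨A, fun δ h0 h1 => ?_⟩
  obtain ⟨J, hJ, hcov⟩ := hA (δ ^ 2) (by positivity) (pow_le_one₀ h0.le h1)
  refine ⟨J, ?_, fun x => ?_⟩
  · rwa [← Real.rpow_natCast, ← Real.rpow_mul h0.le, Nat.cast_ofNat, mul_neg] at hJ
  · obtain ⟨y, hy, hxy⟩ := hcov x
    exact ⟨y, hy, Real.sqrt_le_iff.2 ⟨h0.le, hxy⟩⟩

variable [Fintype ι] {ψ : ι → X → X} {r : ι → ℝ}

theorem CoveringNumberLE.sum_of_selfSimilar (hψ : ∀ x, ∃ i y, ψ i y = x) (hr : ∀ i, 0 < r i)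
    (hd : ∀ i x y, d (ψ i x) (ψ i y) ≤ r i * d x y) {δ : ℝ} {N : ι → ℝ}
    (h : ∀ i, CoveringNumberLE d (δ / r i) (N i)) : CoveringNumberLE d δ (∑ i, N i) := by
  classical
  choose J hJ hcov using h
  refine ⟨Finset.univ.biUnion fun i => (J i).image (ψ i), ?_, fun x => ?_⟩
  · calc (((Finset.univ.biUnion fun i => (J i).image (ψ i)).card : ℕ) : ℝ)
        ≤ ∑ i, ((J i).card : ℝ) := mod_cast Finset.card_biUnion_le.trans
          (Finset.sum_le_sum fun i _ => Finset.card_image_le)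
      _ ≤ ∑ i, N i := Finset.sum_le_sum fun i _ => hJ i
  · obtain ⟨i, x, rfl⟩ := hψ x
    obtain ⟨y, hy, hxy⟩ := hcov i x
    refine ⟨ψ i y, Finset.mem_biUnion.2 ⟨i, Finset.mem_univ i, Finset.mem_image_of_mem _ hy⟩,
      (hd i x y).trans ?_⟩
    rwa [le_div_iff₀' (hr i)] at hxy

theorem coveringNumberLE_rpow_of_selfSimilar [Nonempty X] (hψ : ∀ x, ∃ i y, ψ i y = x)
    {c ρ K κ : ℝ} (hc : 0 < c) (hcr : ∀ i, c ≤ r i) (hrρ : ∀ i, r i ≤ ρ) (hκ : 0 ≤ κ)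
    (hsum : ∑ i, r i ^ κ ≤ 1) (hd : ∀ i x y, d (ψ i x) (ψ i y) ≤ r i * d x y) (hK0 : 0 ≤ K)
    (hK : ∀ x y, d x y ≤ K) (n : ℕ) {δ : ℝ} (hδ : 0 < δ) (hρδ : ρ ^ n ≤ δ) (hδc : δ ≤ c⁻¹) :
    CoveringNumberLE d (K * δ) ((c * δ) ^ (-κ)) := by
  have hr : ∀ i, 0 < r i := fun i => hc.trans_le (hcr i)
  have one_cell : ∀ δ : ℝ, 1 ≤ δ → δ ≤ c⁻¹ → CoveringNumberLE d (K * δ) ((c * δ) ^ (-κ)) := by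
    intro δ h1 hδc
    refine coveringNumberLE_of_forall_le
      (fun x y => (hK x y).trans (le_mul_of_one_le_right hK0 h1))
      (Real.one_le_rpow_of_pos_of_le_one_of_nonpos (by positivity) ?_ (neg_nonpos.2 hκ))
    exact (le_inv_mul_iff₀ hc).1 (by simpa using hδc)
  induction n generalizing δ with
  | zero => exact one_cell δ (by simpa using hρδ) hδc
  | succ n ih =>
    rcases le_or_gt 1 δ with h1 | h1
    · exact one_cell δ h1 hδc
    have hcell : ∀ i, CoveringNumberLE d (K * δ / r i) ((c * (δ / r i)) ^ (-κ)) := by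
      intro i
      rw [mul_div_assoc]
      refine ih (div_pos hδ (hr i)) ?_ ?_
      · rw [le_div_iff₀ (hr i)]
        refine le_trans ?_ hρδ
        rw [pow_succ]
        have := (hr i).le.trans (hrρ i)
        gcongr
        exact hrρ i
      · rw [← one_div]
        exact div_le_div₀ zero_le_one h1.le hc (hcr i)
    refine (CoveringNumberLE.sum_of_selfSimilar hψ hr hd hcell).mono ?_
    calc ∑ i, (c * (δ / r i)) ^ (-κ) = (c * δ) ^ (-κ) * ∑ i, r i ^ κ := by
          rw [Finset.mul_sum]
          refine Finset.sum_congr rfl fun i _ => ?_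
          rw [← mul_div_assoc, Real.div_rpow (by positivity) (hr i).le, Real.rpow_neg (hr i).le,
            div_inv_eq_mul]
      _ ≤ (c * δ) ^ (-κ) := mul_le_of_le_one_right (by positivity) hsum

theorem hasCoveringExponent_of_selfSimilar [Nonempty X] (hψ : ∀ x, ∃ i y, ψ i y = x)
    (hr0 : ∀ i, 0 < r i) (hr1 : ∀ i, r i < 1) {κ : ℝ} (hκ : 0 ≤ κ) (hsum : ∑ i, r i ^ κ ≤ 1)
    (hd : ∀ i x y, d (ψ i x) (ψ i y) ≤ r i * d x y) (hbdd : ∃ K, ∀ x y, d x y ≤ K) :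
    HasCoveringExponent d κ := by
  obtain ⟨i₀, -, -⟩ := hψ (Classical.arbitrary X)
  have : Nonempty ι := ⟨i₀⟩
  obtain ⟨imin, hmin⟩ := Finite.exists_min r
  obtain ⟨imax, hmax⟩ := Finite.exists_max r
  obtain ⟨K, hK⟩ := hbdd
  have hK0 : 0 < max K 1 := by positivity
  refine ⟨(r imin / max K 1) ^ (-κ), fun δ h0 h1 => ?_⟩
  have hδK : 0 < δ / max K 1 := by positivity
  obtain ⟨n, hn⟩ := exists_pow_lt_of_lt_one hδK (hr1 imax)
  have hle_one : δ / max K 1 ≤ 1 := div_le_one_of_le₀ (h1.trans (le_max_right _ _)) hK0.le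
  have h := coveringNumberLE_rpow_of_selfSimilar hψ (hr0 imin) hmin hmax hκ hsum hd hK0.le
    (fun x y => (hK x y).trans (le_max_left _ _)) n hδK hn.le
    (hle_one.trans ((one_le_inv₀ (hr0 imin)).2 (hr1 imin).le))
  rwa [mul_div_cancel₀ _ hK0.ne', ← mul_div_assoc, mul_div_right_comm,
    Real.mul_rpow (div_pos (hr0 imin) hK0).le h0.le] at h

theorem hasCoveringExponent_Icc {a b : ℝ} (hab : a ≤ b) :
    HasCoveringExponent (fun s t : Set.Icc a b => |(s : ℝ) - (t : ℝ)|) 1 := by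
  have : Nonempty (Set.Icc a b) := ⟨⟨a, Set.left_mem_Icc.2 hab⟩⟩
  let halve (i : Fin 2) (t : Set.Icc a b) : Set.Icc a b :=
    ⟨(![a, b] i + t) / 2, by
      obtain ⟨t, hat, htb⟩ := t
      fin_cases i <;> constructor <;> simp <;> linarith⟩
  refine hasCoveringExponent_of_selfSimilar (ψ := halve) (r := fun _ => 1 / 2) ?_
    (by norm_num) (by norm_num) zero_le_one (by norm_num) (fun i s t => ?_)
    ⟨b - a, fun s t => abs_sub_le_of_le_of_le s.2.1 s.2.2 t.2.1 t.2.2⟩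
  · rintro ⟨t, hat, htb⟩
    rcases le_total t ((a + b) / 2) with h | h
    · exact ⟨0, ⟨2 * t - a, by linarith, by linarith⟩, Subtype.ext (by simp [halve])⟩
    · exact ⟨1, ⟨2 * t - b, by linarith, by linarith⟩, Subtype.ext (by simp [halve])⟩
  · have hsub : (halve i s : ℝ) - halve i t = 1 / 2 * ((s : ℝ) - t) := by simp only [halve]; ring
    rw [hsub, abs_mul, abs_of_pos one_half_pos]

end Covering

section Chaining

variable {X E : Type*} [PseudoMetricSpace X] [MetricSpace E]

/-- Finite `2⁻ⁿ`-nets of a space, with a choice `proj n x` of a point of the `n`-th net within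
`2⁻ⁿ` of `x`. -/
structure DyadicNets (X : Type*) [PseudoMetricSpace X] where
  net : ℕ → Finset X
  proj : ℕ → X → X
  proj_mem : ∀ n x, proj n x ∈ net n
  dist_proj_le : ∀ n x, dist x (proj n x) ≤ (1 / 2) ^ n

namespace DyadicNets

open Classical in
/-- The points of two consecutive nets; a chain approximating a point moves inside these sets. -/
noncomputable def twoNets (D : DyadicNets X) (n : ℕ) : Finset X := D.net n ∪ D.net (n + 1)

theorem proj_mem_twoNets (D : DyadicNets X) (n : ℕ) (x : X) : D.proj n x ∈ D.twoNets n :=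
  by classical exact Finset.mem_union_left _ (D.proj_mem n x)

theorem proj_succ_mem_twoNets (D : DyadicNets X) (n : ℕ) (x : X) :
    D.proj (n + 1) x ∈ D.twoNets n :=
  by classical exact Finset.mem_union_right _ (D.proj_mem (n + 1) x)

theorem tendsto_dist_proj (D : DyadicNets X) (x : X) :
    Tendsto (fun n => dist x (D.proj n x)) atTop (𝓝 0) :=
  squeeze_zero (fun _ => dist_nonneg) (D.dist_proj_le · x)
    (tendsto_pow_atTop_nhds_zero_of_lt_one (by norm_num) (by norm_num))

theorem exists_card_net_le {κ : ℝ} (h : HasCoveringExponent (dist : X → X → ℝ) κ) :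
    ∃ (D : DyadicNets X) (A : ℝ), 1 ≤ A ∧ ∀ n, ((D.net n).card : ℝ) ≤ A * ((2 : ℝ) ^ κ) ^ n := by
  obtain ⟨A, hA⟩ := h
  choose net hcard hcov using fun n : ℕ => hA ((1 / 2) ^ n) (by positivity)
    (pow_le_one₀ (by norm_num) (by norm_num))
  choose proj hmem hdist using hcov
  refine ⟨⟨net, proj, hmem, hdist⟩, max A 1, le_max_right _ _, fun n => (hcard n).trans ?_⟩
  have hscale : ((1 / 2 : ℝ) ^ n) ^ (-κ) = ((2 : ℝ) ^ κ) ^ n := by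
    rw [Real.rpow_pow_comm two_pos.le, one_div, inv_pow, Real.inv_rpow (by positivity),
      Real.rpow_neg (by positivity), inv_inv]
  rw [hscale]
  gcongr
  exact le_max_left _ _

theorem card_twoNets_le {D : DyadicNets X} {A b : ℝ} (hA : 0 ≤ A) (hb : 1 ≤ b)
    (hD : ∀ n, ((D.net n).card : ℝ) ≤ A * b ^ n) (n : ℕ) :
    ((D.twoNets n).card : ℝ) ≤ 2 * A * b * b ^ n :=
  calc ((D.twoNets n).card : ℝ) ≤ (D.net n).card + (D.net (n + 1)).card :=
        mod_cast by classical exact Finset.card_union_le _ _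
    _ ≤ A * b ^ n + A * b ^ (n + 1) := add_le_add (hD n) (hD (n + 1))
    _ ≤ A * b ^ (n + 1) + A * b ^ (n + 1) := by gcongr; exact n.le_succ
    _ = 2 * A * b * b ^ n := by ring

end DyadicNets

/-- The increments of `f` between `2⁻ⁿ`-close points of consecutive nets are `O(2^(-ηn))`: the
hypothesis of the chaining argument. The factor `4` makes room for pairs `proj n x`, `proj n y`
with `dist x y ≤ 2⁻ⁿ`. -/
def GeometricIncrements (D : DyadicNets X) (η c : ℝ) (f : X → E) : Prop :=
  ∀ n, ∀ s ∈ D.twoNets n, ∀ t ∈ D.twoNets n, dist s t ≤ 4 * (1 / 2) ^ n →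
    dist (f s) (f t) ≤ c * ((1 / 2 : ℝ) ^ η) ^ n

theorem one_half_rpow_lt_one {η : ℝ} (hη : 0 < η) : (1 / 2 : ℝ) ^ η < 1 :=
  Real.rpow_lt_one (by norm_num) (by norm_num) hη

theorem exists_holder_of_dist_le_pow {η b B : ℝ} (hη : 0 < η) (hb : 0 ≤ b) {g : X → E}
    (hnear : ∀ n x y, dist x y ≤ (1 / 2) ^ n → dist (g x) (g y) ≤ b * ((1 / 2 : ℝ) ^ η) ^ n)
    (hbdd : ∀ x y, dist (g x) (g y) ≤ B) :
    ∃ c : ℝ, ∀ x y, dist (g x) (g y) ≤ c * dist x y ^ η := by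
  refine ⟨max (b * 2 ^ η) B, fun x y => ?_⟩
  rcases (dist_nonneg (x := x) (y := y)).eq_or_lt with h0 | h0
  · have hlim : Tendsto (fun n : ℕ => b * ((1 / 2 : ℝ) ^ η) ^ n) atTop (𝓝 (b * 0)) :=
      (tendsto_pow_atTop_nhds_zero_of_lt_one (by positivity) (one_half_rpow_lt_one hη)).const_mul b
    rw [← h0, Real.zero_rpow hη.ne', mul_zero]
    rw [mul_zero] at hlim
    exact ge_of_tendsto' hlim fun n => hnear n x y (by rw [← h0]; positivity)
  rcases le_or_gt (dist x y) 1 with h1 | h1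
  · obtain ⟨n, hn_lt, hn_le⟩ := exists_nat_pow_near_of_lt_one h0 h1 (y := (1 / 2 : ℝ))
      (by norm_num) (by norm_num)
    calc dist (g x) (g y) ≤ b * ((1 / 2 : ℝ) ^ η) ^ n := hnear n x y hn_le
      _ = b * ((1 / 2 : ℝ) ^ n) ^ η := by rw [Real.rpow_pow_comm (by norm_num)]
      _ ≤ b * (2 * dist x y) ^ η := by gcongr; rw [pow_succ] at hn_lt; linarith
      _ = b * 2 ^ η * dist x y ^ η := by rw [Real.mul_rpow two_pos.le h0.le, mul_assoc]
      _ ≤ max (b * 2 ^ η) B * dist x y ^ η := by gcongr; exact le_max_left _ _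
  · calc dist (g x) (g y) ≤ max (b * 2 ^ η) B := (hbdd x y).trans (le_max_right _ _)
      _ ≤ max (b * 2 ^ η) B * dist x y ^ η :=
        le_mul_of_one_le_right (le_max_of_le_left (by positivity)) (Real.one_le_rpow h1.le hη.le)

namespace GeometricIncrements

variable {D : DyadicNets X} {η c : ℝ} {f g : X → E}

theorem mono_exponent {η' : ℝ} (h : GeometricIncrements D η c f) (hη : η' ≤ η) :
    GeometricIncrements D η' |c| f := fun n s hs t ht hst =>
  (h n s hs t ht hst).trans <| mul_le_mul (le_abs_self c)
    (pow_le_pow_left₀ (by positivity)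
      (Real.rpow_le_rpow_of_exponent_ge (by norm_num) (by norm_num) hη) n)
    (by positivity) (abs_nonneg c)

theorem dist_proj_succ_le (h : GeometricIncrements D η c f) (x : X) (n : ℕ) :
    dist (f (D.proj n x)) (f (D.proj (n + 1) x)) ≤ c * ((1 / 2 : ℝ) ^ η) ^ n := by
  refine h n _ (D.proj_mem_twoNets n x) _ (D.proj_succ_mem_twoNets n x) ?_
  have htri := dist_triangle_left (D.proj n x) (D.proj (n + 1) x) x
  have hn := D.dist_proj_le n x
  have hn1 := D.dist_proj_le (n + 1) x
  have hpos : (0 : ℝ) < (1 / 2) ^ n := by positivity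
  rw [pow_succ] at hn1
  linarith

theorem cauchySeq (h : GeometricIncrements D η c f) (hη : 0 < η) (x : X) :
    CauchySeq fun n => f (D.proj n x) :=
  cauchySeq_of_le_geometric _ c (one_half_rpow_lt_one hη) (h.dist_proj_succ_le x)

theorem dist_limit_le (h : GeometricIncrements D η c f) (hη : 0 < η)
    (hg : ∀ x, Tendsto (fun n => f (D.proj n x)) atTop (𝓝 (g x))) (n : ℕ) (x : X) :
    dist (f (D.proj n x)) (g x) ≤ c / (1 - (1 / 2 : ℝ) ^ η) * ((1 / 2 : ℝ) ^ η) ^ n :=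
  (dist_le_of_le_geometric_of_tendsto _ c (one_half_rpow_lt_one hη) (h.dist_proj_succ_le x)
    (hg x) n).trans_eq (div_mul_eq_mul_div _ _ _).symm

theorem dist_limit_le_of_dist_le_pow (h : GeometricIncrements D η c f) (hη : 0 < η)
    (hg : ∀ x, Tendsto (fun n => f (D.proj n x)) atTop (𝓝 (g x))) {n : ℕ} {x y : X}
    (hxy : dist x y ≤ (1 / 2) ^ n) :
    dist (g x) (g y) ≤ (2 * (c / (1 - (1 / 2 : ℝ) ^ η)) + c) * ((1 / 2 : ℝ) ^ η) ^ n := by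
  have hproj : dist (D.proj n x) (D.proj n y) ≤ 4 * (1 / 2) ^ n := by
    have htri := dist_triangle4 (D.proj n x) x y (D.proj n y)
    have hpos : (0 : ℝ) < (1 / 2) ^ n := by positivity
    linarith [dist_comm (D.proj n x) x, D.dist_proj_le n x, D.dist_proj_le n y]
  linarith [dist_triangle4 (g x) (f (D.proj n x)) (f (D.proj n y)) (g y),
    dist_comm (g x) (f (D.proj n x)),
    h.dist_limit_le hη hg n x, h.dist_limit_le hη hg n y,
    h n _ (D.proj_mem_twoNets n x) _ (D.proj_mem_twoNets n y) hproj]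

theorem exists_dist_limit_le (h : GeometricIncrements D η c f) (hη : 0 < η)
    (hg : ∀ x, Tendsto (fun n => f (D.proj n x)) atTop (𝓝 (g x))) :
    ∃ B, ∀ x y, dist (g x) (g y) ≤ B := by
  obtain ⟨B, hB⟩ := Metric.isBounded_iff.1 ((D.net 0).finite_toSet.image f).isBounded
  refine ⟨2 * (c / (1 - (1 / 2 : ℝ) ^ η)) + B, fun x y => ?_⟩
  have hx := h.dist_limit_le hη hg 0 x
  have hy := h.dist_limit_le hη hg 0 y
  rw [pow_zero, mul_one] at hx hy
  linarith [dist_triangle4 (g x) (f (D.proj 0 x)) (f (D.proj 0 y)) (g y),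
    dist_comm (g x) (f (D.proj 0 x)),
    hB (Set.mem_image_of_mem f (D.proj_mem 0 x)) (Set.mem_image_of_mem f (D.proj_mem 0 y))]

theorem exists_holder (h : GeometricIncrements D η c f) (hη : 0 < η)
    (hg : ∀ x, Tendsto (fun n => f (D.proj n x)) atTop (𝓝 (g x))) :
    ∃ c' : ℝ, ∀ x y, dist (g x) (g y) ≤ c' * dist x y ^ η := by
  obtain hX | ⟨⟨x₀⟩⟩ := isEmpty_or_nonempty X
  · exact ⟨0, fun x => hX.elim x⟩
  have hc : 0 ≤ c := by simpa using dist_nonneg.trans (h.dist_proj_succ_le x₀ 0)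
  have hq : 0 < 1 - (1 / 2 : ℝ) ^ η := sub_pos.2 (one_half_rpow_lt_one hη)
  obtain ⟨B, hB⟩ := h.exists_dist_limit_le hη hg
  exact exists_holder_of_dist_le_pow hη (by positivity)
    (fun _ _ _ hxy => h.dist_limit_le_of_dist_le_pow hη hg hxy) hB

end GeometricIncrements

end Chaining

section Moments

variable {X E Ω : Type*} [PseudoMetricSpace X] [MetricSpace E] [MeasurableSpace Ω]
  {P : Measure Ω} {ξ : X → Ω → E} {p q : ℝ} {M : ℝ≥0}

/-- The largest increment of `f` between points at distance at most `c` of a finite set `J`. -/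
noncomputable def maxIncrement (J : Finset X) (c : ℝ≥0∞) (f : X → E) : ℝ≥0∞ :=
  ⨆ (s : J) (t : {t : J // edist s t ≤ c}), edist (f s) (f t)

theorem edist_le_maxIncrement {J : Finset X} {c : ℝ≥0∞} {f : X → E} {s t : X} (hs : s ∈ J)
    (ht : t ∈ J) (hst : edist s t ≤ c) : edist (f s) (f t) ≤ maxIncrement J c f :=
  le_iSup₂_of_le (⟨s, hs⟩ : J) ⟨⟨t, ht⟩, hst⟩ le_rfl

theorem measurable_maxIncrement (h : IsKolmogorovProcess ξ P p q M) (J : Finset X) (c : ℝ≥0∞) :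
    Measurable fun ω => maxIncrement J c (ξ · ω) :=
  Measurable.iSup fun _ => Measurable.iSup fun _ => h.measurable_edist

theorem iSup_rpow_le_sum {ι : Type*} (s : Finset ι) (a : ι → ℝ≥0∞) (hp : 0 < p) :
    (⨆ i : s, a i) ^ p ≤ ∑ i ∈ s, a i ^ p := by
  rw [← ENNReal.le_rpow_inv_iff hp]
  refine iSup_le fun i => (ENNReal.le_rpow_inv_iff hp).2 ?_
  exact Finset.single_le_sum (f := fun i => a i ^ p) (fun _ _ => zero_le) i.2

/-- Pair reduction leaves only `a * #J` increments to control, instead of `#J ^ 2`: this is what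
gives the Hölder exponent `(q - κ) / p` for a space with covering exponent `κ`. -/
theorem lintegral_maxIncrement_rpow_le (h : IsKolmogorovProcess ξ P p q M) {J : Finset X}
    {a : ℝ≥0∞} {n : ℕ} (hJ : J.card ≤ a ^ n) (c : ℝ≥0∞) :
    ∫⁻ ω, maxIncrement J c (ξ · ω) ^ p ∂P ≤ 2 ^ p * (a * J.card * (M * (n * c) ^ q)) := by
  obtain ⟨K, -, hcard, hclose, hK⟩ := EMetric.pair_reduction hJ c E
  calc ∫⁻ ω, maxIncrement J c (ξ · ω) ^ p ∂P
      ≤ ∫⁻ ω, 2 ^ p * ∑ k ∈ K, edist (ξ k.1 ω) (ξ k.2 ω) ^ p ∂P := by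
        refine lintegral_mono fun ω => ?_
        refine (ENNReal.rpow_le_rpow (hK (ξ · ω)) h.p_pos.le).trans ?_
        rw [ENNReal.mul_rpow_of_nonneg _ _ h.p_pos.le]
        gcongr
        exact iSup_rpow_le_sum K (fun k => edist (ξ k.1 ω) (ξ k.2 ω)) h.p_pos
    _ = 2 ^ p * ∑ k ∈ K, ∫⁻ ω, edist (ξ k.1 ω) (ξ k.2 ω) ^ p ∂P := by
        rw [lintegral_const_mul _ (Finset.measurable_sum _ fun _ _ =>
          h.measurable_edist.pow_const p),
          lintegral_finsetSum _ fun _ _ => h.measurable_edist.pow_const p]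
    _ ≤ 2 ^ p * ∑ _k ∈ K, (M * (n * c) ^ q : ℝ≥0∞) := by
        gcongr with k hk
        refine (h.kolmogorovCondition _ _).trans ?_
        have := h.q_pos.le
        gcongr
        exact hclose _ _ hk
    _ ≤ 2 ^ p * (a * J.card * (M * (n * c) ^ q)) := by
        rw [Finset.sum_const, nsmul_eq_mul]
        gcongr

theorem exists_lintegral_maxIncrement_twoNets_le (h : IsKolmogorovProcess ξ P p q M)
    {D : DyadicNets X} {A κ : ℝ} (hA : 1 ≤ A) (hκ : 0 ≤ κ)
    (hD : ∀ n, ((D.net n).card : ℝ) ≤ A * ((2 : ℝ) ^ κ) ^ n) :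
    ∃ L : ℝ, ∀ n : ℕ,
      ∫⁻ ω, maxIncrement (D.twoNets n) (ENNReal.ofReal (4 * (1 / 2) ^ n)) (ξ · ω) ^ p ∂P ≤
        ENNReal.ofReal (L * (((n : ℝ) + 1) ^ q * ((2 : ℝ) ^ (κ - q)) ^ n)) := by
  have hb1 : 1 ≤ (2 : ℝ) ^ κ := Real.one_le_rpow one_le_two hκ
  set b : ℝ := 2 * A * 2 ^ κ
  have hb : (2 : ℝ) ^ κ ≤ b := le_mul_of_one_le_left (by positivity) (by linarith)
  have hcard (n : ℕ) : ((D.twoNets n).card : ℝ≥0∞) ≤ ENNReal.ofReal (b * (2 ^ κ) ^ n) := by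
    rw [← ENNReal.ofReal_natCast]
    exact ENNReal.ofReal_le_ofReal (D.card_twoNets_le (by linarith) hb1 hD n)
  have hpow (n : ℕ) : ((D.twoNets n).card : ℝ≥0∞) ≤ ENNReal.ofReal b ^ (n + 1) := by
    rw [← ENNReal.ofReal_pow (by positivity), pow_succ']
    refine (hcard n).trans (ENNReal.ofReal_le_ofReal ?_)
    gcongr
  refine ⟨2 ^ p * (b * b * M * 4 ^ q), fun n =>
    (lintegral_maxIncrement_rpow_le h (hpow n) _).trans ?_⟩
  have hscale : ((((n + 1 : ℕ) : ℝ) * (4 * (1 / 2) ^ n)) ^ q : ℝ) =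
      4 ^ q * ((n : ℝ) + 1) ^ q * (((2 : ℝ) ^ q)⁻¹) ^ n := by
    rw [Real.mul_rpow (by positivity) (by positivity),
      Real.mul_rpow (by positivity) (by positivity), ← Real.rpow_pow_comm (by norm_num), one_div,
      Real.inv_rpow two_pos.le, Nat.cast_succ]
    ring
  calc (2 ^ p * (ENNReal.ofReal b * (D.twoNets n).card *
        (M * (((n + 1 : ℕ) : ℝ≥0∞) * ENNReal.ofReal (4 * (1 / 2) ^ n)) ^ q)) : ℝ≥0∞)
      ≤ ENNReal.ofReal (2 ^ p) * (ENNReal.ofReal b * ENNReal.ofReal (b * (2 ^ κ) ^ n) *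
        (ENNReal.ofReal M *
          ENNReal.ofReal ((((n + 1 : ℕ) : ℝ) * (4 * (1 / 2) ^ n)) ^ q))) := by
        rw [← ENNReal.ofReal_rpow_of_nonneg two_pos.le h.p_pos.le, ENNReal.ofReal_ofNat,
          ← ENNReal.ofReal_rpow_of_nonneg (by positivity) h.q_pos.le,
          ENNReal.ofReal_mul (p := ((n + 1 : ℕ) : ℝ)) (by positivity), ENNReal.ofReal_natCast,
          ENNReal.ofReal_coe_nnreal]
        gcongr
        exact hcard n
    _ = ENNReal.ofReal
        (2 ^ p * (b * b * M * 4 ^ q) * (((n : ℝ) + 1) ^ q * ((2 : ℝ) ^ (κ - q)) ^ n)) := by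
        rw [hscale, Real.rpow_sub two_pos, div_eq_mul_inv, mul_pow]
        repeat rw [← ENNReal.ofReal_mul (by positivity)]
        ring_nf

theorem summable_rpow_mul_geometric (s : ℝ) {ρ : ℝ} (h0 : 0 < ρ) (h1 : ρ < 1) :
    Summable (fun n : ℕ => ((n : ℝ) + 1) ^ s * ρ ^ n) := by
  obtain ⟨k, hk⟩ := exists_nat_ge s
  have h := (_root_.summable_nat_add_iff 1).2 (summable_pow_mul_geometric_of_norm_lt_one k
    (r := ρ) (by rwa [Real.norm_of_nonneg h0.le]))
  refine Summable.of_nonneg_of_le (fun n => by positivity) (fun n => ?_) (h.mul_left ρ⁻¹)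
  calc ((n : ℝ) + 1) ^ s * ρ ^ n ≤ ((n : ℝ) + 1) ^ (k : ℝ) * ρ ^ n := by
        gcongr
        linarith [n.cast_nonneg (α := ℝ)]
    _ = ρ⁻¹ * (((n + 1 : ℕ) : ℝ) ^ k * ρ ^ (n + 1)) := by
        rw [Real.rpow_natCast, pow_succ ρ]
        push_cast
        field_simp

theorem ae_exists_forall_le_of_tsum_lintegral_ne_top {f : ℕ → Ω → ℝ≥0∞}
    (hf : ∀ n, Measurable (f n)) (hsum : ∑' n, ∫⁻ ω, f n ω ∂P ≠ ⊤) :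
    ∀ᵐ ω ∂P, ∃ C ≠ ⊤, ∀ n, f n ω ≤ C := by
  rw [← lintegral_tsum fun n => (hf n).aemeasurable] at hsum
  filter_upwards [ae_lt_top (Measurable.tsum hf) hsum] with ω hω
  exact ⟨_, hω.ne, fun n => ENNReal.le_tsum n⟩

theorem exists_geometricIncrements_of_maxIncrement_le {D : DyadicNets X} {η : ℝ} {f : X → E}
    {C : ℝ≥0∞} (hC : C ≠ ⊤)
    (hf : ∀ n : ℕ, ENNReal.ofReal (((2 : ℝ) ^ η) ^ n) *
      maxIncrement (D.twoNets n) (ENNReal.ofReal (4 * (1 / 2) ^ n)) f ≤ C) :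
    GeometricIncrements D η C.toReal f := by
  intro n s hs t ht hst
  have hedist : ENNReal.ofReal (((2 : ℝ) ^ η) ^ n) * edist (f s) (f t) ≤ C := by
    refine le_trans ?_ (hf n)
    gcongr
    exact edist_le_maxIncrement hs ht (by rw [edist_dist]; exact ENNReal.ofReal_le_ofReal hst)
  have hreal := ENNReal.toReal_mono hC hedist
  rw [ENNReal.toReal_mul, ENNReal.toReal_ofReal (by positivity), edist_dist,
    ENNReal.toReal_ofReal dist_nonneg] at hreal
  rwa [one_div, Real.inv_rpow two_pos.le, inv_pow, ← div_eq_mul_inv, le_div_iff₀' (by positivity)]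

theorem ae_exists_geometricIncrements (h : IsKolmogorovProcess ξ P p q M) {D : DyadicNets X}
    {A κ η : ℝ} (hA : 1 ≤ A) (hκ : 0 ≤ κ)
    (hD : ∀ n, ((D.net n).card : ℝ) ≤ A * ((2 : ℝ) ^ κ) ^ n) (hη : η < (q - κ) / p) :
    ∀ᵐ ω ∂P, ∃ c, GeometricIncrements D η c (ξ · ω) := by
  obtain ⟨L, hL⟩ := exists_lintegral_maxIncrement_twoNets_le h hA hκ hD
  let weighted (n : ℕ) (ω : Ω) : ℝ≥0∞ := ENNReal.ofReal (((2 : ℝ) ^ η) ^ n) *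
    maxIncrement (D.twoNets n) (ENNReal.ofReal (4 * (1 / 2) ^ n)) (ξ · ω)
  have hratio : (2 : ℝ) ^ (η * p + (κ - q)) < 1 :=
    Real.rpow_lt_one_of_one_lt_of_neg one_lt_two (by rw [lt_div_iff₀ h.p_pos] at hη; linarith)
  have hmoment (n : ℕ) : ∫⁻ ω, weighted n ω ^ p ∂P ≤
      ENNReal.ofReal (L * (((n : ℝ) + 1) ^ q * ((2 : ℝ) ^ (η * p + (κ - q))) ^ n)) := by
    simp only [weighted, ENNReal.mul_rpow_of_nonneg _ _ h.p_pos.le]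
    rw [lintegral_const_mul _ ((measurable_maxIncrement h _ _).pow_const p),
      ENNReal.ofReal_rpow_of_nonneg (by positivity) h.p_pos.le]
    refine (mul_le_mul_right (hL n) _).trans_eq ?_
    rw [← ENNReal.ofReal_mul (by positivity), Real.rpow_add two_pos, Real.rpow_mul two_pos.le,
      mul_pow, ← Real.rpow_pow_comm (by positivity)]
    ring_nf
  have hsum : ∑' n, ∫⁻ ω, weighted n ω ^ p ∂P ≠ ⊤ :=
    ne_top_of_le_ne_top ((summable_rpow_mul_geometric q (by positivity)
      hratio).mul_left L).tsum_ofReal_ne_top (ENNReal.tsum_le_tsum hmoment)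
  filter_upwards [ae_exists_forall_le_of_tsum_lintegral_ne_top
    (fun n => ((measurable_maxIncrement h _ _).const_mul _).pow_const p) hsum] with ω ⟨C, hC, hle⟩
  exact ⟨_, exists_geometricIncrements_of_maxIncrement_le
    (ENNReal.rpow_ne_top_of_nonneg (inv_nonneg.2 h.p_pos.le) hC)
    fun n => (ENNReal.le_rpow_inv_iff h.p_pos).2 (hle n)⟩

theorem ae_forall_exists_geometricIncrements (h : IsKolmogorovProcess ξ P p q M)
    {D : DyadicNets X} {A κ : ℝ} (hA : 1 ≤ A) (hκ : 0 ≤ κ)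
    (hD : ∀ n, ((D.net n).card : ℝ) ≤ A * ((2 : ℝ) ^ κ) ^ n) :
    ∀ᵐ ω ∂P, ∀ η < (q - κ) / p, ∃ c, GeometricIncrements D η c (ξ · ω) := by
  have hrat : ∀ᵐ ω ∂P, ∀ η : ℚ, (η : ℝ) < (q - κ) / p →
      ∃ c, GeometricIncrements D η c (ξ · ω) := by
    rw [ae_all_iff]
    intro η
    rw [eventually_imp_distrib_left]
    exact ae_exists_geometricIncrements h hA hκ hD
  filter_upwards [hrat] with ω hω η hη
  obtain ⟨η', hηη', hη'⟩ := exists_rat_btwn hη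
  obtain ⟨c, hc⟩ := hω η' hη'
  exact ⟨_, hc.mono_exponent hηη'.le⟩

end Moments

theorem essentiallyHolder_of_holder {X E : Type*} [MetricSpace E] {d : X → X → ℝ}
    (hd : ∀ x y, 0 ≤ d x y) {δ : ℝ} (hδ : 0 < δ) {f : X → E}
    (h : ∀ η, 0 < η → η < δ → ∃ c : ℝ, ∀ x y, dist (f x) (f y) ≤ c * d x y ^ η) :
    EssentiallyHolder d δ f := by
  refine ⟨fun x ε hε => ?_, h⟩
  obtain ⟨c, hc⟩ := h (δ / 2) (by linarith) (by linarith)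
  have hcpos : (0 : ℝ) < |c| + 1 := by positivity
  refine ⟨(ε / (|c| + 1)) ^ (δ / 2)⁻¹, by positivity, fun y hy => ?_⟩
  have hpow : d x y ^ (δ / 2) < ε / (|c| + 1) :=
    (Real.lt_rpow_inv_iff_of_pos (hd x y) (by positivity) (by positivity)).1 hy
  have hpow0 : 0 ≤ d x y ^ (δ / 2) := Real.rpow_nonneg (hd x y) _
  calc dist (f x) (f y) ≤ c * d x y ^ (δ / 2) := hc x y
    _ ≤ (|c| + 1) * d x y ^ (δ / 2) := by gcongr; linarith [le_abs_self c]
    _ < (|c| + 1) * (ε / (|c| + 1)) := by gcongr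
    _ = ε := mul_div_cancel₀ ε hcpos.ne'

theorem EssentiallyHolder.comp {X Y E : Type*} [MetricSpace E] {d : X → X → ℝ} {e : Y → Y → ℝ}
    {δ : ℝ} {f : X → E} (hf : EssentiallyHolder d δ f) (φ : Y → X)
    (hφ : ∀ a b, d (φ a) (φ b) = e a b) : EssentiallyHolder e δ (fun y => f (φ y)) := by
  refine ⟨fun x ε hε => ?_, fun η h0 h1 => ?_⟩
  · obtain ⟨a, ha, h⟩ := hf.1 (φ x) ε hε
    exact ⟨a, ha, fun y hy => h _ (by rwa [hφ])⟩
  · obtain ⟨c, hc⟩ := hf.2 η h0 h1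
    exact ⟨c, fun x y => by rw [← hφ]; exact hc _ _⟩

section KolmogorovChentsov

variable {X E Ω : Type*} [PseudoMetricSpace X] [MetricSpace E] [MeasurableSpace Ω]
  {P : Measure Ω} {ξ ξ' : X → Ω → E} {p q κ : ℝ} {M : ℝ≥0} {D : DyadicNets X}

theorem essentiallyHolder_of_geometricIncrements {f g : X → E} {δ : ℝ} (hδ : 0 < δ)
    (hf : ∀ η < δ, ∃ c, GeometricIncrements D η c f)
    (hg : ∀ x, Tendsto (fun n => f (D.proj n x)) atTop (𝓝 (g x))) :
    EssentiallyHolder dist δ g :=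
  essentiallyHolder_of_holder (fun _ _ => dist_nonneg) hδ fun η h0 h1 =>
    let ⟨_, hc⟩ := hf η h1
    hc.exists_holder h0 hg

theorem ae_tendsto_proj (h : IsKolmogorovProcess ξ P p q M) (D : DyadicNets X) (x : X) :
    ∀ᵐ ω ∂P, Tendsto (fun n => ξ (D.proj n x) ω) atTop (𝓝 (ξ x ω)) := by
  have hmeas (n : ℕ) : Measurable fun ω => edist (ξ (D.proj n x) ω) (ξ x ω) ^ p :=
    h.measurable_edist.pow_const p
  have hmoment (n : ℕ) : ∫⁻ ω, edist (ξ (D.proj n x) ω) (ξ x ω) ^ p ∂P ≤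
      ENNReal.ofReal (M * ((1 / 2 : ℝ) ^ q) ^ n) := by
    refine (h.kolmogorovCondition _ _).trans ?_
    rw [edist_dist, ENNReal.ofReal_rpow_of_nonneg dist_nonneg h.q_pos.le,
      ENNReal.ofReal_mul M.coe_nonneg, ENNReal.ofReal_coe_nnreal,
      Real.rpow_pow_comm (by norm_num)]
    have := h.q_pos.le
    gcongr
    exact (dist_comm _ _).trans_le (D.dist_proj_le n x)
  have hsum : ∫⁻ ω, ∑' n, edist (ξ (D.proj n x) ω) (ξ x ω) ^ p ∂P ≠ ⊤ := by
    rw [lintegral_tsum fun n => (hmeas n).aemeasurable]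
    exact ne_top_of_le_ne_top ((summable_geometric_of_lt_one (by positivity)
      (one_half_rpow_lt_one h.q_pos)).mul_left _).tsum_ofReal_ne_top (ENNReal.tsum_le_tsum hmoment)
  filter_upwards [ae_lt_top (Measurable.tsum hmeas) hsum] with ω hω
  have hlim := (ENNReal.continuous_rpow_const (y := p⁻¹)).continuousAt.tendsto.comp
    (ENNReal.tendsto_atTop_zero_of_tsum_ne_top hω.ne)
  rw [ENNReal.zero_rpow_of_pos (inv_pos.2 h.p_pos)] at hlim
  exact tendsto_iff_edist_tendsto_0.2
    (hlim.congr fun n => ENNReal.rpow_rpow_inv h.p_pos.ne' _)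

theorem exists_measurable_tendsto_proj [CompleteSpace E] [MeasurableSpace E] [BorelSpace E]
    (h : IsKolmogorovProcess ξ P p q M) {η : ℝ} (hη : 0 < η)
    (hD : ∀ᵐ ω ∂P, ∃ c, GeometricIncrements D η c (ξ · ω)) :
    ∃ ξ' : X → Ω → E, (∀ x, Measurable (ξ' x)) ∧
      ∀ᵐ ω ∂P, ∀ x, Tendsto (fun n => ξ (D.proj n x) ω) atTop (𝓝 (ξ' x ω)) := by
  classical
  obtain ⟨G, hG_ae, hG, hinc⟩ := hD.exists_measurable_mem
  let u (n : ℕ) (x : X) (ω : Ω) : E := if ω ∈ G then ξ (D.proj n x) ω else ξ x ω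
  have hconv (x : X) (ω : Ω) : ∃ y, Tendsto (u · x ω) atTop (𝓝 y) := by
    by_cases hω : ω ∈ G
    · obtain ⟨c, hc⟩ := hinc ω hω
      simpa only [u, if_pos hω] using cauchySeq_tendsto_of_complete (hc.cauchySeq hη x)
    · exact ⟨ξ x ω, by simp only [u, if_neg hω]; exact tendsto_const_nhds⟩
  choose ξ' hξ' using hconv
  refine ⟨ξ', fun x => measurable_of_tendsto_metrizable
    (fun n => (h.measurable _).ite hG (h.measurable x)) (tendsto_pi_nhds.2 (hξ' x)), ?_⟩
  filter_upwards [hG_ae] with ω hω x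
  simpa only [u, if_pos hω] using hξ' x ω

theorem exists_essentiallyHolder_modification [CompleteSpace E] [MeasurableSpace E] [BorelSpace E]
    (h : IsKolmogorovProcess ξ P p q M) (hcov : HasCoveringExponent (dist : X → X → ℝ) κ)
    (hκ : 0 ≤ κ) (hκq : κ < q) :
    ∃ ξ' : X → Ω → E, (∀ x, Measurable (ξ' x)) ∧ (∀ x, ∀ᵐ ω ∂P, ξ' x ω = ξ x ω) ∧
      ∀ᵐ ω ∂P, EssentiallyHolder dist ((q - κ) / p) (ξ' · ω) := by
  obtain ⟨D, A, hA, hD⟩ := DyadicNets.exists_card_net_le hcov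
  have hδ : 0 < (q - κ) / p := div_pos (sub_pos.2 hκq) h.p_pos
  have hinc := ae_forall_exists_geometricIncrements h hA hκ hD
  obtain ⟨ξ', hmeas, hlim⟩ := exists_measurable_tendsto_proj h (half_pos hδ)
    (hinc.mono fun ω hω => hω _ (half_lt_self hδ))
  refine ⟨ξ', hmeas, fun x => ?_, ?_⟩
  · filter_upwards [hlim, ae_tendsto_proj h D x] with ω hω' hω
    exact tendsto_nhds_unique (hω' x) hω
  · filter_upwards [hinc, hlim] with ω hω hω'
    exact essentiallyHolder_of_geometricIncrements hδ hω hω'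

theorem essentiallyHolder_of_modification (h : IsKolmogorovProcess ξ P p q M)
    (hcov : HasCoveringExponent (dist : X → X → ℝ) κ) (hκ : 0 ≤ κ) (hκq : κ < q)
    (hmod : ∀ x, ∀ᵐ ω ∂P, ξ' x ω = ξ x ω) (hcont : ∀ᵐ ω ∂P, Continuous (ξ' · ω)) :
    ∀ᵐ ω ∂P, EssentiallyHolder dist ((q - κ) / p) (ξ' · ω) := by
  obtain ⟨D, A, hA, hD⟩ := DyadicNets.exists_card_net_le hcov
  have hδ : 0 < (q - κ) / p := div_pos (sub_pos.2 hκq) h.p_pos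
  have heq : ∀ᵐ ω ∂P, ∀ n, ∀ s ∈ D.net n, ξ' s ω = ξ s ω :=
    ae_all_iff.2 fun n => (ae_ball_iff (D.net n).countable_toSet).2 fun s _ => hmod s
  filter_upwards [ae_forall_exists_geometricIncrements h hA hκ hD, hcont, heq]
    with ω hinc hω hnet
  refine essentiallyHolder_of_geometricIncrements hδ hinc fun x => ?_
  have hproj : Tendsto (D.proj · x) atTop (𝓝 x) :=
    tendsto_iff_dist_tendsto_zero.2 (by simpa only [dist_comm x] using D.tendsto_dist_proj x)
  exact (hω.continuousAt.tendsto.comp hproj).congr fun n => hnet n _ (D.proj_mem n x)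

end KolmogorovChentsov

section SquaredMetric

variable {X Y E Ω : Type*} {d : X → X → ℝ} {e : Y → Y → ℝ}

theorem sqrt_rpow_two_mul {a : ℝ} (ha : 0 ≤ a) (s : ℝ) : √a ^ (2 * s) = a ^ s := by
  rw [Real.sqrt_eq_rpow, ← Real.rpow_mul ha, one_div, inv_mul_cancel_left₀ two_ne_zero]

/-- `d` is the square of a pseudo-metric. Every pseudo-metric is one, and for the resistance between
the points of a network this weak form of the triangle inequality comes out directly; it suffices
for Hölder estimates, since `d ^ η = √d ^ (2 * η)`. -/
structure IsSqPseudoMetric (d : X → X → ℝ) : Prop where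
  nonneg : ∀ x y, 0 ≤ d x y
  self : ∀ x, d x x = 0
  symm : ∀ x y, d x y = d y x
  triangle : ∀ x y z, √(d x z) ≤ √(d x y) + √(d y z)

namespace IsSqPseudoMetric

theorem of_triangle (nonneg : ∀ x y, 0 ≤ d x y) (self : ∀ x, d x x = 0)
    (symm : ∀ x y, d x y = d y x) (triangle : ∀ x y z, d x z ≤ d x y + d y z) :
    IsSqPseudoMetric d where
  nonneg := nonneg
  self := self
  symm := symm
  triangle x y z := (Real.sqrt_le_sqrt (triangle x y z)).trans <| Real.sqrt_le_iff.2
    ⟨by positivity, by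
      rw [add_sq, Real.sq_sqrt (nonneg x y), Real.sq_sqrt (nonneg y z)]
      linarith [mul_nonneg (Real.sqrt_nonneg (d x y)) (Real.sqrt_nonneg (d y z))]⟩

theorem abs_sub (s : Set ℝ) : IsSqPseudoMetric fun a b : s => |(a : ℝ) - (b : ℝ)| :=
  .of_triangle (fun _ _ => abs_nonneg _) (fun _ => by simp) (fun _ _ => abs_sub_comm _ _)
    (fun _ _ _ => abs_sub_le _ _ _)

theorem prod (hd : IsSqPseudoMetric d) (he : IsSqPseudoMetric e) :
    IsSqPseudoMetric fun p q : X × Y => max (d p.1 q.1) (e p.2 q.2) where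
  nonneg p q := le_max_of_le_left (hd.nonneg _ _)
  self p := by simp [hd.self, he.self]
  symm p q := by rw [hd.symm, he.symm]
  triangle p q s := by
    simp only [Real.sqrt_monotone.map_max]
    exact max_le
      ((hd.triangle _ q.1 _).trans (add_le_add (le_max_left _ _) (le_max_left _ _)))
      ((he.triangle _ q.2 _).trans (add_le_add (le_max_right _ _) (le_max_right _ _)))

/-- The pseudo-metric `√d`. -/
noncomputable abbrev pseudoMetricSpace (hd : IsSqPseudoMetric d) : PseudoMetricSpace X where
  dist x y := √(d x y)
  dist_self x := by simp [hd.self]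
  dist_comm x y := by simp [hd.symm x y]
  dist_triangle := hd.triangle

theorem continuous_of_essentiallyHolder [MetricSpace E] (hd : IsSqPseudoMetric d) {δ : ℝ}
    {f : X → E} (hf : EssentiallyHolder d δ f) :
    letI := hd.pseudoMetricSpace
    Continuous f := by
  let := hd.pseudoMetricSpace
  refine Metric.continuous_iff'.2 fun x ε hε => ?_
  obtain ⟨η, hη, hfη⟩ := hf.1 x ε hε
  filter_upwards [Metric.ball_mem_nhds x (Real.sqrt_pos.2 hη)] with y hy
  rw [Metric.mem_ball'] at hy
  rw [dist_comm]
  exact hfη y ((Real.sqrt_lt_sqrt_iff (hd.nonneg x y)).1 hy)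

theorem essentiallyHolder_of_sqrt [MetricSpace E] (hd : IsSqPseudoMetric d) {δ : ℝ} (hδ : 0 < δ)
    {f : X → E} (hf : EssentiallyHolder (fun x y => √(d x y)) (2 * δ) f) :
    EssentiallyHolder d δ f :=
  essentiallyHolder_of_holder hd.nonneg hδ fun η h0 h1 => by
    obtain ⟨c, hc⟩ := hf.2 (2 * η) (by linarith) (by linarith)
    exact ⟨c, fun x y => (hc x y).trans_eq (by rw [sqrt_rpow_two_mul (hd.nonneg x y)])⟩

theorem exists_le_of_hasCoveringExponent (hd : IsSqPseudoMetric d) {κ : ℝ}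
    (h : HasCoveringExponent d κ) : ∃ K, ∀ x y, d x y ≤ K := by
  let := hd.pseudoMetricSpace
  obtain ⟨A, hA⟩ := h
  obtain ⟨J, -, hJ⟩ := hA 1 one_pos le_rfl
  have huniv : Bornology.IsBounded (Set.univ : Set X) := by
    refine ((Bornology.isBounded_biUnion_finset J).2 fun y _ => Metric.isBounded_closedBall
      (x := y) (r := 1)).subset fun x _ => ?_
    obtain ⟨y, hy, hxy⟩ := hJ x
    exact Set.mem_biUnion hy (Real.sqrt_le_one.2 hxy)
  obtain ⟨B, hB⟩ := Metric.isBounded_iff.1 huniv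
  exact ⟨B ^ 2, fun x y => (Real.sqrt_le_iff.1 (hB (Set.mem_univ x) (Set.mem_univ y))).2⟩

variable [MetricSpace E] [SecondCountableTopology E] [MeasurableSpace E] [BorelSpace E]
  [MeasurableSpace Ω] {P : Measure Ω} {ξ ξ' : X → Ω → E} {C p q κ : ℝ}

theorem isKolmogorovProcess (hd : IsSqPseudoMetric d) (hξ : ∀ x, Measurable (ξ x)) (hp : 0 < p)
    (hq : 0 < q)
    (hmom : ∀ x y, ∫⁻ ω, edist (ξ x ω) (ξ y ω) ^ p ∂P ≤ ENNReal.ofReal (C * d x y ^ q)) :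
    letI := hd.pseudoMetricSpace
    IsKolmogorovProcess ξ P p (2 * q) C.toNNReal := by
  let := hd.pseudoMetricSpace
  refine .mk_of_secondCountableTopology hξ (fun x y => (hmom x y).trans_eq ?_) hp (by positivity)
  rw [ENNReal.ofReal_mul' (Real.rpow_nonneg (hd.nonneg x y) q), edist_dist,
    ENNReal.ofReal_rpow_of_nonneg dist_nonneg (by positivity), ← sqrt_rpow_two_mul (hd.nonneg x y)]
  rfl

theorem exists_essentiallyHolder_modification [CompleteSpace E] (hd : IsSqPseudoMetric d)
    (hcov : HasCoveringExponent d κ) (hκ : 0 ≤ κ) (hκq : κ < q) (hξ : ∀ x, Measurable (ξ x))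
    (hp : 0 < p)
    (hmom : ∀ x y, ∫⁻ ω, edist (ξ x ω) (ξ y ω) ^ p ∂P ≤ ENNReal.ofReal (C * d x y ^ q)) :
    ∃ ξ' : X → Ω → E, (∀ x, Measurable (ξ' x)) ∧ (∀ x, ∀ᵐ ω ∂P, ξ' x ω = ξ x ω) ∧
      ∀ᵐ ω ∂P, EssentiallyHolder d ((q - κ) / p) (ξ' · ω) := by
  let := hd.pseudoMetricSpace
  obtain ⟨ξ', hmeas, hmod, hholder⟩ := PCF.exists_essentiallyHolder_modification
    (hd.isKolmogorovProcess hξ hp (hκ.trans_lt hκq) hmom) hcov.sqrt (by positivity) (by linarith)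
  rw [← mul_sub, mul_div_assoc] at hholder
  exact ⟨ξ', hmeas, hmod, hholder.mono fun ω =>
    hd.essentiallyHolder_of_sqrt (div_pos (sub_pos.2 hκq) hp)⟩

theorem essentiallyHolder_of_modification (hd : IsSqPseudoMetric d)
    (hcov : HasCoveringExponent d κ) (hκ : 0 ≤ κ) (hκq : κ < q) (hξ : ∀ x, Measurable (ξ x))
    (hp : 0 < p)
    (hmom : ∀ x y, ∫⁻ ω, edist (ξ x ω) (ξ y ω) ^ p ∂P ≤ ENNReal.ofReal (C * d x y ^ q))
    (hmod : ∀ x, ∀ᵐ ω ∂P, ξ' x ω = ξ x ω) {δ : ℝ}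
    (hcont : ∀ᵐ ω ∂P, EssentiallyHolder d δ (ξ' · ω)) :
    ∀ᵐ ω ∂P, EssentiallyHolder d ((q - κ) / p) (ξ' · ω) := by
  let := hd.pseudoMetricSpace
  have hholder := PCF.essentiallyHolder_of_modification
    (hd.isKolmogorovProcess hξ hp (hκ.trans_lt hκq) hmom) hcov.sqrt (by positivity) (by linarith)
    hmod (hcont.mono fun ω => hd.continuous_of_essentiallyHolder)
  rw [← mul_sub, mul_div_assoc] at hholder
  exact hholder.mono fun ω => hd.essentiallyHolder_of_sqrt (div_pos (sub_pos.2 hκq) hp)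

end IsSqPseudoMetric

end SquaredMetric

section JointMoments

theorem rpow_le_rpow_mul_of_le {u v K s s' : ℝ} (hu : 0 ≤ u) (huv : u ≤ v) (hvK : v ≤ K)
    (hs : 0 < s) (hss' : s ≤ s') : u ^ s' ≤ K ^ (s' - s) * v ^ s := by
  have hv : 0 ≤ v := hu.trans huv
  calc u ^ s' ≤ v ^ s' := Real.rpow_le_rpow hu huv (hs.le.trans hss')
    _ = v ^ (s' - s) * v ^ s := by
        rw [← Real.rpow_add_of_nonneg hv (by linarith) hs.le, sub_add_cancel]
    _ ≤ K ^ (s' - s) * v ^ s := by gcongr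

theorem lintegral_edist_rpow_triangle_le {Ω E : Type*} [MeasurableSpace Ω] [MetricSpace E]
    [SecondCountableTopology E] [MeasurableSpace E] [BorelSpace E] (P : Measure Ω)
    {X Y Z : Ω → E} (hX : Measurable X) (hY : Measurable Y) {p : ℝ} (hp : 0 ≤ p) :
    ∫⁻ ω, edist (X ω) (Z ω) ^ p ∂P ≤
      2 ^ p * (∫⁻ ω, edist (X ω) (Y ω) ^ p ∂P + ∫⁻ ω, edist (Y ω) (Z ω) ^ p ∂P) := by
  rw [← lintegral_add_left ((hX.edist hY).pow_const p),
    ← lintegral_const_mul' _ _ (by finiteness)]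
  refine lintegral_mono fun ω => ?_
  have htri : edist (X ω) (Z ω) ≤ 2 * max (edist (X ω) (Y ω)) (edist (Y ω) (Z ω)) := by
    rw [two_mul]
    exact (edist_triangle _ _ _).trans (add_le_add (le_max_left _ _) (le_max_right _ _))
  refine (ENNReal.rpow_le_rpow htri hp).trans ?_
  rw [ENNReal.mul_rpow_of_nonneg _ _ hp, (ENNReal.monotone_rpow_of_nonneg hp).map_max]
  gcongr
  exact max_le le_self_add le_add_self

variable {X Y E Ω : Type*} {d : X → X → ℝ} {e : Y → Y → ℝ}
  [MetricSpace E] [SecondCountableTopology E] [MeasurableSpace E] [BorelSpace E]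
  [MeasurableSpace Ω] {P : Measure Ω} {ξ : X → Y → Ω → E} {C p a b s K : ℝ}

theorem exists_lintegral_edist_rpow_le_max (hd : ∀ x x', 0 ≤ d x x') (he : ∀ y y', 0 ≤ e y y')
    (hdK : ∀ x x', d x x' ≤ K) (heK : ∀ y y', e y y' ≤ K) (hs : 0 < s) (hsa : s ≤ a) (hsb : s ≤ b)
    (hξ : ∀ x y, Measurable (ξ x y)) (hp : 0 ≤ p)
    (hmom_e : ∀ x y y', ∫⁻ ω, edist (ξ x y ω) (ξ x y' ω) ^ p ∂P ≤
      ENNReal.ofReal (C * e y y' ^ a))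
    (hmom_d : ∀ x x' y, ∫⁻ ω, edist (ξ x y ω) (ξ x' y ω) ^ p ∂P ≤
      ENNReal.ofReal (C * d x x' ^ b)) :
    ∃ C' : ℝ, ∀ z w : X × Y, ∫⁻ ω, edist (ξ z.1 z.2 ω) (ξ w.1 w.2 ω) ^ p ∂P ≤
      ENNReal.ofReal (C' * max (d z.1 w.1) (e z.2 w.2) ^ s) := by
  refine ⟨2 ^ p * (|C| * K ^ (a - s) + |C| * K ^ (b - s)), fun z w => ?_⟩
  set m := max (d z.1 w.1) (e z.2 w.2)
  have hm : 0 ≤ m := le_max_of_le_left (hd _ _)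
  have hmK : m ≤ K := max_le (hdK _ _) (heK _ _)
  have hK : 0 ≤ K := hm.trans hmK
  have hspace : C * e z.2 w.2 ^ a ≤ |C| * K ^ (a - s) * m ^ s := by
    rw [mul_assoc]
    exact mul_le_mul (le_abs_self C) (rpow_le_rpow_mul_of_le (he _ _) (le_max_right _ _) hmK hs hsa)
      (Real.rpow_nonneg (he _ _) _) (abs_nonneg C)
  have htime : C * d z.1 w.1 ^ b ≤ |C| * K ^ (b - s) * m ^ s := by
    rw [mul_assoc]
    exact mul_le_mul (le_abs_self C) (rpow_le_rpow_mul_of_le (hd _ _) (le_max_left _ _) hmK hs hsb)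
      (Real.rpow_nonneg (hd _ _) _) (abs_nonneg C)
  refine (lintegral_edist_rpow_triangle_le P (Y := ξ z.1 w.2) (hξ _ _) (hξ _ _) hp).trans ?_
  rw [mul_assoc, ENNReal.ofReal_mul (by positivity), ← ENNReal.ofReal_rpow_of_pos two_pos,
    ENNReal.ofReal_ofNat, add_mul, ENNReal.ofReal_add (by positivity) (by positivity)]
  gcongr
  · exact (hmom_e _ _ _).trans (ENNReal.ofReal_le_ofReal hspace)
  · exact (hmom_d _ _ _).trans (ENNReal.ofReal_le_ofReal htime)

end JointMoments

theorem exists_dist_le_of_reflTransGen {ι V α : Type*} [Finite ι] [PseudoMetricSpace α]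
    (φ : V → ι → α) {N : V → ℝ} (hN : ∀ v, 0 ≤ N v) {rel : ι → ι → Prop}
    (hconn : ∀ a b, Relation.ReflTransGen rel a b)
    (hrel : ∀ a b, rel a b → ∃ K, ∀ v, dist (φ v a) (φ v b) ≤ K * N v) :
    ∃ K, 0 ≤ K ∧ ∀ v a b, dist (φ v a) (φ v b) ≤ K * N v := by
  have hpair (a b : ι) : ∃ K, ∀ v, dist (φ v a) (φ v b) ≤ K * N v := by
    induction hconn a b with
    | refl => exact ⟨0, fun v => by simp⟩
    | tail _ hbc ih =>
      obtain ⟨K₁, h₁⟩ := ih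
      obtain ⟨K₂, h₂⟩ := hrel _ _ hbc
      exact ⟨K₁ + K₂, fun v => (dist_triangle _ _ _).trans <|
        (add_le_add (h₁ v) (h₂ v)).trans_eq (add_mul _ _ _).symm⟩
  choose K hK using hpair
  obtain ⟨B, hB⟩ := (Set.finite_range fun p : ι × ι => K p.1 p.2).bddAbove
  refine ⟨max B 0, le_max_right _ _, fun v a b => (hK a b v).trans ?_⟩
  exact mul_le_mul_of_nonneg_right ((hB ⟨(a, b), rfl⟩).trans (le_max_left _ _)) (hN v)

section Laplacian

variable {ι : Type*} [Fintype ι] {A : Matrix ι ι ℝ}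

open Matrix

/-- The matrix `A` is the Laplacian of a connected graph on `ι` with conductances `A p q`, with the
sign convention of the Laplace operator: `-uᵀ A u` is the energy of `u`. -/
structure IsConnectedLaplacian (A : Matrix ι ι ℝ) : Prop where
  symm : A.IsSymm
  offDiag_nonneg : ∀ p q, p ≠ q → 0 ≤ A p q
  ker_eq : ∀ u : ι → ℝ, A *ᵥ u = 0 ↔ ∃ c : ℝ, ∀ p, u p = c

theorem neg_dotProduct_mulVec_eq_sum_sq_sub (hA : A.IsSymm) (hsum : ∀ p, ∑ q, A p q = 0)
    (u : ι → ℝ) : -(u ⬝ᵥ A *ᵥ u) = (1 / 2) * ∑ p, ∑ q, A p q * (u p - u q) ^ 2 := by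
  have hrow : ∑ p, ∑ q, A p q * u p ^ 2 = 0 := by
    simp_rw [← Finset.sum_mul, hsum, zero_mul, Finset.sum_const_zero]
  have hcol : ∑ p, ∑ q, A p q * u q ^ 2 = 0 := by
    rw [Finset.sum_comm, ← hrow]
    exact Finset.sum_congr rfl fun p _ => Finset.sum_congr rfl fun q _ => by rw [hA.apply]
  have hexpand : ∑ p, ∑ q, A p q * (u p - u q) ^ 2 = ∑ p, ∑ q, A p q * u p ^ 2 +
      ∑ p, ∑ q, A p q * u q ^ 2 - 2 * u ⬝ᵥ A *ᵥ u := by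
    simp_rw [dotProduct, mulVec, dotProduct, Finset.mul_sum, ← Finset.sum_add_distrib,
      ← Finset.sum_sub_distrib]
    exact Finset.sum_congr rfl fun p _ => Finset.sum_congr rfl fun q _ => by ring
  rw [hexpand, hrow, hcol]
  ring

namespace IsConnectedLaplacian

theorem sum_row (hA : IsConnectedLaplacian A) (p : ι) : ∑ q, A p q = 0 := by
  simpa [mulVec, dotProduct] using congrFun ((hA.ker_eq fun _ => 1).2 ⟨1, fun _ => rfl⟩) p

theorem mul_sq_sub_nonneg (hA : IsConnectedLaplacian A) (u : ι → ℝ) (p q : ι) :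
    0 ≤ A p q * (u p - u q) ^ 2 := by
  obtain rfl | hpq := eq_or_ne p q
  · simp
  · exact mul_nonneg (hA.offDiag_nonneg p q hpq) (sq_nonneg _)

theorem neg_dotProduct_mulVec_nonneg (hA : IsConnectedLaplacian A) (u : ι → ℝ) :
    0 ≤ -(u ⬝ᵥ A *ᵥ u) := by
  rw [neg_dotProduct_mulVec_eq_sum_sq_sub hA.symm hA.sum_row]
  exact mul_nonneg one_half_pos.le
    (Finset.sum_nonneg fun p _ => Finset.sum_nonneg fun q _ => hA.mul_sq_sub_nonneg u p q)

theorem neg_dotProduct_mulVec_affine (hA : IsConnectedLaplacian A) (u : ι → ℝ) (a b : ℝ) :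
    -((fun p => a * u p + b) ⬝ᵥ A *ᵥ fun p => a * u p + b) = a ^ 2 * -(u ⬝ᵥ A *ᵥ u) := by
  simp only [neg_dotProduct_mulVec_eq_sum_sq_sub hA.symm hA.sum_row, Finset.mul_sum]
  exact Finset.sum_congr rfl fun p _ => Finset.sum_congr rfl fun q _ => by ring

theorem sq_sub_le_of_pos (hA : IsConnectedLaplacian A) {p q : ι} (hpq : 0 < A p q) (u : ι → ℝ) :
    (u p - u q) ^ 2 ≤ 2 * (A p q)⁻¹ * -(u ⬝ᵥ A *ᵥ u) := by
  have hterm : A p q * (u p - u q) ^ 2 ≤ ∑ p, ∑ q, A p q * (u p - u q) ^ 2 :=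
    (Finset.single_le_sum (f := fun q => A p q * (u p - u q) ^ 2)
      (fun q _ => hA.mul_sq_sub_nonneg u p q) (Finset.mem_univ q)).trans
    (Finset.single_le_sum (f := fun p => ∑ q, A p q * (u p - u q) ^ 2)
      (fun p _ => Finset.sum_nonneg fun q _ => hA.mul_sq_sub_nonneg u p q) (Finset.mem_univ p))
  rw [neg_dotProduct_mulVec_eq_sum_sq_sub hA.symm hA.sum_row]
  calc (u p - u q) ^ 2 = (A p q)⁻¹ * (A p q * (u p - u q) ^ 2) := by field_simp
    _ ≤ (A p q)⁻¹ * ∑ p, ∑ q, A p q * (u p - u q) ^ 2 := by gcongr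
    _ = _ := by ring

theorem reflTransGen_pos (hA : IsConnectedLaplacian A) (p q : ι) :
    Relation.ReflTransGen (fun a b => 0 < A a b) p q := by
  classical
  -- The indicator function of a connected component is harmonic, hence constant.
  set comp : Set ι := {a | Relation.ReflTransGen (fun a b => 0 < A a b) p a}
  have hcross {a b : ι} (ha : a ∈ comp) (hb : b ∉ comp) : A a b = 0 :=
    le_antisymm (not_lt.1 fun h => hb (ha.tail h))
      (hA.offDiag_nonneg a b fun hab => hb (hab ▸ ha))
  have hharm : A *ᵥ comp.indicator 1 = 0 := by
    funext a
    by_cases ha : a ∈ comp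
    · rw [Pi.zero_apply, ← hA.sum_row a]
      refine Finset.sum_congr rfl fun b _ => ?_
      by_cases hb : b ∈ comp
      · simp [hb]
      · simp [hb, hcross ha hb]
    · refine Finset.sum_eq_zero fun b _ => ?_
      by_cases hb : b ∈ comp
      · simp [(hA.symm.apply a b).symm.trans (hcross hb ha)]
      · simp [hb]
  obtain ⟨c, hc⟩ := (hA.ker_eq _).1 hharm
  have hp : p ∈ comp := Relation.ReflTransGen.refl
  have hq : comp.indicator (1 : ι → ℝ) q = 1 := by
    rw [hc q, ← hc p, Set.indicator_of_mem hp, Pi.one_apply]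
  exact Set.mem_of_indicator_ne_zero (hq.trans_ne one_ne_zero)

theorem exists_abs_sub_le (hA : IsConnectedLaplacian A) :
    ∃ K, 0 ≤ K ∧ ∀ (u : ι → ℝ) p q, |u p - u q| ≤ K * √(-(u ⬝ᵥ A *ᵥ u)) :=
  exists_dist_le_of_reflTransGen id (fun _ => Real.sqrt_nonneg _) hA.reflTransGen_pos
    fun p q hpq => ⟨√(2 * (A p q)⁻¹), fun u => by
      rw [← Real.sqrt_mul (by positivity)]
      exact Real.abs_le_sqrt (hA.sq_sub_le_of_pos hpq u)⟩

end IsConnectedLaplacian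

end Laplacian

theorem reflTransGen_inter_nonempty {X ι : Type*} [TopologicalSpace X] [PreconnectedSpace X]
    [Finite ι] {s : ι → Set X} (hclosed : ∀ i, IsClosed (s i)) (hne : ∀ i, (s i).Nonempty)
    (hcover : ∀ x, ∃ i, x ∈ s i) (i j : ι) :
    Relation.ReflTransGen (fun k l => (s k ∩ s l).Nonempty) i j := by
  by_contra hj
  set I : Set ι := {k | Relation.ReflTransGen (fun k l => (s k ∩ s l).Nonempty) i k}
  have hunion (J : Set ι) : IsClosed (⋃ k ∈ J, s k) :=
    J.toFinite.isClosed_biUnion fun k _ => hclosed k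
  obtain ⟨x, -, hx, hx'⟩ := isPreconnected_closed_iff.1 isPreconnected_univ _ _
    (hunion I) (hunion Iᶜ)
    (fun x _ => (hcover x).elim fun k hk => (em (k ∈ I)).imp
      (fun hkI => Set.mem_biUnion hkI hk) (fun hkI => Set.mem_biUnion hkI hk))
    (let ⟨y, hy⟩ := hne i; ⟨y, Set.mem_univ y, Set.mem_biUnion .refl hy⟩)
    (let ⟨y, hy⟩ := hne j; ⟨y, Set.mem_univ y, Set.mem_biUnion hj hy⟩)
  obtain ⟨k, hk, hxk⟩ := Set.mem_iUnion₂.1 hx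
  obtain ⟨l, hl, hxl⟩ := Set.mem_iUnion₂.1 hx'
  exact hl (Relation.ReflTransGen.tail hk ⟨x, hxk, hxl⟩)

namespace SelfSimilarSet

variable {M : ℕ} {F : Type*} [MetricSpace F] (S : SelfSimilarSet M F)

theorem continuous_ψ (i : Fin M) : Continuous (S.ψ i) :=
  (S.contracting i).elim fun _ hK => hK.2.continuous

/-- The contraction `ψ i` as a continuous map, with which the continuous functions on `F` are
pulled back to the cell `ψ i (F)`. -/
def cellMap (i : Fin M) : C(F, F) := ⟨S.ψ i, S.continuous_ψ i⟩

theorem exists_ψ_eq (x : F) : ∃ i y, S.ψ i y = x :=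
  Set.mem_iUnion.1 (S.cover.symm ▸ Set.mem_univ x)

theorem nonempty_fin (S : SelfSimilarSet M F) : Nonempty (Fin M) :=
  ⟨⟨0, two_pos.trans_le S.two_le⟩⟩

theorem wordMap_cons {n : ℕ} (i : Fin M) (w : Fin n → Fin M) :
    S.wordMap (Fin.cons i w : Fin (n + 1) → Fin M) = S.ψ i ∘ S.wordMap w := by
  simp only [wordMap, Fin.cons_zero, Fin.tail_cons]

variable [CompactSpace F] [Nonempty F]

theorem proj_eq_ψ_proj_shift (ω : ℕ → Fin M) :
    S.proj ω = S.ψ (ω 0) (S.proj fun k => ω (k + 1)) := by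
  refine (S.eq_proj ω _ fun n => ?_).symm
  cases n with
  | zero => exact ⟨_, rfl⟩
  | succ n =>
    obtain ⟨y, hy⟩ := S.proj_mem (fun k => ω (k + 1)) n
    exact ⟨y, congrArg (S.ψ (ω 0)) hy⟩

theorem proj_surjective : Function.Surjective S.proj := by
  choose i y hiy using S.exists_ψ_eq
  have hcode (n : ℕ) (x : F) : x ∈ Set.range (S.wordMap (wordPrefix (fun k => i (y^[k] x)) n)) := by
    induction n generalizing x with
    | zero => exact ⟨x, rfl⟩
    | succ n ih =>
      obtain ⟨a, ha⟩ := ih (y x)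
      exact ⟨a, (congrArg (S.ψ (i x)) ha).trans (hiy x)⟩
  exact fun x => ⟨_, (S.eq_proj _ x fun n => hcode n x).symm⟩

theorem tendsto_wordMap_wordPrefix (ω : ℕ → Fin M) (x : F) :
    Tendsto (fun n => S.wordMap (wordPrefix ω n) x) atTop (𝓝 (S.proj ω)) := by
  obtain ⟨K, hK1, hK⟩ := S.exists_ratio
  have hbound (n : ℕ) : dist (S.wordMap (wordPrefix ω n) x) (S.proj ω) ≤
      (K : ℝ) ^ n * Metric.diam (Set.univ : Set F) := by
    obtain ⟨a, ha⟩ := S.proj_mem ω n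
    rw [← ha]
    refine ((S.lipschitzWith_wordMap hK n _).dist_le_mul x a).trans ?_
    rw [NNReal.coe_pow]
    gcongr
    exact Metric.dist_le_diam_of_mem isCompact_univ.isBounded (Set.mem_univ _) (Set.mem_univ _)
  refine tendsto_iff_dist_tendsto_zero.2 (squeeze_zero (fun _ => dist_nonneg) hbound ?_)
  simpa only [zero_mul] using
    (tendsto_pow_atTop_nhds_zero_of_lt_one K.coe_nonneg (NNReal.coe_lt_one.2 hK1)).mul_const _

theorem mem_boundary_of_ψ_mem_overlap {i : Fin M} {x : F} (h : S.ψ i x ∈ S.overlap) :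
    x ∈ S.boundary := by
  obtain ⟨ω, rfl⟩ := S.proj_surjective x
  refine ⟨ω, ⟨1, le_rfl, fun k => Nat.casesOn k i ω, ?_, rfl⟩, rfl⟩
  rw [S.proj_eq_ψ_proj_shift]
  exact h

theorem exists_boundary_of_ψ_eq {i j : Fin M} (hij : i ≠ j) {a b : F} (h : S.ψ i a = S.ψ j b) :
    a ∈ S.boundary ∧ b ∈ S.boundary :=
  ⟨S.mem_boundary_of_ψ_mem_overlap ⟨i, j, hij, ⟨a, rfl⟩, ⟨b, h.symm⟩⟩,
    S.mem_boundary_of_ψ_mem_overlap ⟨i, j, hij, ⟨a, h⟩, ⟨b, rfl⟩⟩⟩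

theorem exists_ψ_eq_of_mem_boundary {p : F} (hp : p ∈ S.boundary) :
    ∃ i, ∃ q ∈ S.boundary, S.ψ i q = p := by
  obtain ⟨_, ⟨n, hn, τ, hτ, rfl⟩, rfl⟩ := hp
  refine ⟨τ n, S.proj fun k => τ (k + (n + 1)), ⟨_, ⟨n + 1, by omega, τ, hτ, rfl⟩, rfl⟩, ?_⟩
  rw [S.proj_eq_ψ_proj_shift fun k => τ (k + n)]
  simp only [zero_add, add_assoc, add_comm 1 n]

theorem reflTransGen_cell_inter [PreconnectedSpace F] (i j : Fin M) :
    Relation.ReflTransGen (fun k l => (Set.range (S.ψ k) ∩ Set.range (S.ψ l)).Nonempty) i j :=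
  reflTransGen_inter_nonempty (fun k => (isCompact_range (S.continuous_ψ k)).isClosed)
    (fun _ => Set.range_nonempty _) S.exists_ψ_eq i j

theorem boundary_nonempty [PreconnectedSpace F] : S.boundary.Nonempty := by
  by_contra hempty
  have hdisj (k l : Fin M) (hkl : (Set.range (S.ψ k) ∩ Set.range (S.ψ l)).Nonempty) : k = l := by
    by_contra hne
    obtain ⟨_, ⟨a, rfl⟩, ⟨b, hb⟩⟩ := hkl
    exact hempty ⟨a, (S.exists_boundary_of_ψ_eq hne hb.symm).1⟩
  have := Fin.nontrivial_iff_two_le.2 S.two_le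
  obtain ⟨i, j, hij⟩ := exists_pair_ne (Fin M)
  have heq := Relation.ReflTransGen.mono hdisj _ _ (S.reflTransGen_cell_inter i j)
  rw [Relation.reflTransGen_eq_self] at heq
  exact hij heq

end SelfSimilarSet

section Energy

variable {M : ℕ} {F : Type*} [MetricSpace F] [CompactSpace F] [Nonempty F] {S : PCFSet M F}

theorem levelEnergy_zero (A : Matrix S.boundary S.boundary ℝ) (r : Fin M → ℝ) (u : F → ℝ) :
    levelEnergy S A r 0 u = boundaryEnergy S A fun p => u p := by
  simp [levelEnergy, SelfSimilarSet.wordMap]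

theorem levelEnergy_succ (A : Matrix S.boundary S.boundary ℝ) (r : Fin M → ℝ) (m : ℕ)
    (u : F → ℝ) :
    levelEnergy S A r (m + 1) u = ∑ i, (r i)⁻¹ * levelEnergy S A r m (u ∘ S.ψ i) := by
  unfold levelEnergy
  rw [← (Fin.consEquiv fun _ => Fin M).sum_comp, Fintype.sum_prod_type]
  refine Finset.sum_congr rfl fun i _ => ?_
  rw [Finset.mul_sum]
  refine Finset.sum_congr rfl fun w _ => ?_
  simp [Fin.consEquiv, Fin.prod_univ_succ, SelfSimilarSet.wordMap_cons, mul_assoc,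
    mul_left_comm]

namespace RegularHarmonicStructure

variable (H : RegularHarmonicStructure S)

theorem isConnectedLaplacian : IsConnectedLaplacian H.A :=
  ⟨H.symm, H.offDiag_nonneg, H.ker_eq⟩

theorem levelEnergy_nonneg (m : ℕ) (u : F → ℝ) : 0 ≤ levelEnergy S H.A H.r m u :=
  Finset.sum_nonneg fun _ _ => mul_nonneg
    (inv_nonneg.2 (Finset.prod_nonneg fun _ _ => (H.r_pos _).le))
    (H.isConnectedLaplacian.neg_dotProduct_mulVec_nonneg _)

theorem levelEnergy_affine (m : ℕ) (u : F → ℝ) (a b : ℝ) :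
    levelEnergy S H.A H.r m (fun x => a * u x + b) = a ^ 2 * levelEnergy S H.A H.r m u := by
  rw [levelEnergy, levelEnergy, Finset.mul_sum]
  refine Finset.sum_congr rfl fun w _ => ?_
  rw [mul_left_comm]
  exact congrArg _ (H.isConnectedLaplacian.neg_dotProduct_mulVec_affine _ a b)

theorem levelEnergy_comp_ψ_le (i : Fin M) (m : ℕ) (u : F → ℝ) :
    levelEnergy S H.A H.r m (u ∘ S.ψ i) ≤ H.r i * levelEnergy S H.A H.r (m + 1) u := by
  rw [levelEnergy_succ, ← inv_mul_le_iff₀ (H.r_pos i)]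
  exact Finset.single_le_sum (f := fun i => (H.r i)⁻¹ * levelEnergy S H.A H.r m (u ∘ S.ψ i))
    (fun i _ => mul_nonneg (inv_nonneg.2 (H.r_pos i).le) (H.levelEnergy_nonneg _ _))
    (Finset.mem_univ i)

theorem levelEnergy_le_toReal_energy {f : C(F, ℝ)} (hf : f ∈ H.domain) (m : ℕ) :
    levelEnergy S H.A H.r m f ≤ (H.energy f).toReal :=
  (ENNReal.ofReal_le_iff_le_toReal (LT.lt.ne hf)).1
    (le_iSup (fun m => ENNReal.ofReal (levelEnergy S H.A H.r m f)) m)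

theorem energy_affine (f : C(F, ℝ)) (a b : ℝ) :
    H.energy (a • f + .const F b) = ENNReal.ofReal (a ^ 2) * H.energy f := by
  rw [energy, energy, ENNReal.mul_iSup]
  refine iSup_congr fun m => ?_
  rw [← ENNReal.ofReal_mul (sq_nonneg a), ← H.levelEnergy_affine m f a b]
  rfl

theorem energy_comp_cellMap_le (i : Fin M) (f : C(F, ℝ)) :
    H.energy (f.comp (S.cellMap i)) ≤ ENNReal.ofReal (H.r i) * H.energy f := by
  refine iSup_le fun m => ?_
  refine (ENNReal.ofReal_le_ofReal (H.levelEnergy_comp_ψ_le i m f)).trans ?_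
  rw [ENNReal.ofReal_mul (H.r_pos i).le]
  exact mul_le_mul_right (le_iSup (fun m => ENNReal.ofReal (levelEnergy S H.A H.r m f)) (m + 1)) _

theorem comp_cellMap_mem_domain (i : Fin M) {f : C(F, ℝ)} (hf : f ∈ H.domain) :
    f.comp (S.cellMap i) ∈ H.domain :=
  (H.energy_comp_cellMap_le i f).trans_lt (ENNReal.mul_lt_top ENNReal.ofReal_lt_top hf)

theorem toReal_energy_comp_cellMap_le (i : Fin M) {f : C(F, ℝ)} (hf : f ∈ H.domain) :
    (H.energy (f.comp (S.cellMap i))).toReal ≤ H.r i * (H.energy f).toReal := by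
  have h := ENNReal.toReal_mono (ENNReal.mul_ne_top ENNReal.ofReal_ne_top (LT.lt.ne hf))
    (H.energy_comp_cellMap_le i f)
  rwa [ENNReal.toReal_mul, ENNReal.toReal_ofReal (H.r_pos i).le] at h

theorem sqrt_energy_comp_cellMap_le {i : Fin M} {ρ : ℝ} (hρ : H.r i ≤ ρ) {f : C(F, ℝ)}
    (hf : f ∈ H.domain) :
    √(H.energy (f.comp (S.cellMap i))).toReal ≤ √ρ * √(H.energy f).toReal := by
  rw [← Real.sqrt_mul ((H.r_pos i).le.trans hρ)]
  exact Real.sqrt_le_sqrt ((H.toReal_energy_comp_cellMap_le i hf).trans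
    (mul_le_mul_of_nonneg_right hρ ENNReal.toReal_nonneg))

theorem exists_r_le : ∃ ρ, ρ < 1 ∧ ∀ i, H.r i ≤ ρ := by
  have := S.nonempty_fin
  obtain ⟨i, hi⟩ := Finite.exists_max H.r
  exact ⟨H.r i, H.r_lt_one i, hi⟩

theorem exists_abs_sub_le_of_mem_cell : ∃ K, 0 ≤ K ∧ ∀ (u : F → ℝ) (i : Fin M),
    ∀ p ∈ S.boundary, ∀ q ∈ S.boundary,
      |u (S.ψ i p) - u (S.ψ i q)| ≤ K * √(levelEnergy S H.A H.r 1 u) := by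
  obtain ⟨K, hK0, hK⟩ := H.isConnectedLaplacian.exists_abs_sub_le
  refine ⟨K, hK0, fun u i p hp q hq => (hK (fun p => u (S.ψ i p)) ⟨p, hp⟩ ⟨q, hq⟩).trans ?_⟩
  gcongr
  calc boundaryEnergy S H.A (fun p => u (S.ψ i p))
      = levelEnergy S H.A H.r 0 (u ∘ S.ψ i) := (levelEnergy_zero H.A H.r (u ∘ S.ψ i)).symm
    _ ≤ H.r i * levelEnergy S H.A H.r 1 u := H.levelEnergy_comp_ψ_le i 0 u
    _ ≤ levelEnergy S H.A H.r 1 u :=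
        mul_le_of_le_one_left (H.levelEnergy_nonneg _ _) (H.r_lt_one i).le

variable [PreconnectedSpace F]

theorem exists_abs_sub_ψ_le {p : F} (hp : p ∈ S.boundary) : ∃ K, 0 ≤ K ∧ ∀ (u : F → ℝ) i j,
    |u (S.ψ i p) - u (S.ψ j p)| ≤ K * √(levelEnergy S H.A H.r 1 u) := by
  obtain ⟨K, hK0, hK⟩ := H.exists_abs_sub_le_of_mem_cell
  refine exists_dist_le_of_reflTransGen (fun (u : F → ℝ) i => u (S.ψ i p))
    (fun _ => Real.sqrt_nonneg _) S.reflTransGen_cell_inter ?_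
  rintro i j ⟨_, ⟨a, rfl⟩, ⟨b, hb⟩⟩
  refine ⟨K + K, fun u => ?_⟩
  rw [add_mul]
  obtain rfl | hij := eq_or_ne i j
  · rw [dist_self]
    positivity
  · obtain ⟨ha, hb'⟩ := S.exists_boundary_of_ψ_eq hij hb.symm
    refine (abs_sub_le _ (u (S.ψ i a)) _).trans (add_le_add (hK u i p hp a ha) ?_)
    rw [← hb]
    exact hK u j b hb' p hp

theorem exists_abs_sub_ψ_boundary_le : ∃ K, 0 ≤ K ∧ ∀ f ∈ H.domain, ∀ i,
    ∀ p ∈ S.boundary, ∀ q ∈ S.boundary, |f (S.ψ i p) - f q| ≤ K * √(H.energy f).toReal := by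
  obtain ⟨p₀, hp₀⟩ := S.boundary_nonempty
  obtain ⟨K, hK0, hK⟩ := H.exists_abs_sub_le_of_mem_cell
  obtain ⟨L, hL0, hL⟩ := H.exists_abs_sub_ψ_le hp₀
  refine ⟨K + L + K, by positivity, fun f hf i p hp q hq => ?_⟩
  obtain ⟨j, q', hq', rfl⟩ := S.exists_ψ_eq_of_mem_boundary hq
  calc |f (S.ψ i p) - f (S.ψ j q')|
      ≤ |f (S.ψ i p) - f (S.ψ i p₀)| + |f (S.ψ i p₀) - f (S.ψ j p₀)| +
          |f (S.ψ j p₀) - f (S.ψ j q')| :=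
        (abs_sub_le _ _ _).trans (add_le_add_left (abs_sub_le _ _ _) _)
    _ ≤ (K + L + K) * √(levelEnergy S H.A H.r 1 f) := by
        rw [add_mul, add_mul]
        exact add_le_add (add_le_add (hK f i p hp p₀ hp₀) (hL f i j)) (hK f j p₀ hp₀ q' hq')
    _ ≤ (K + L + K) * √(H.energy f).toReal := by
        gcongr
        exact H.levelEnergy_le_toReal_energy hf 1

theorem exists_abs_sub_wordMap_le : ∃ K, 0 ≤ K ∧ ∀ (n : ℕ) (w : Fin n → Fin M), ∀ f ∈ H.domain,
    ∀ p ∈ S.boundary, ∀ q ∈ S.boundary,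
      |f (S.wordMap w p) - f q| ≤ K * √(H.energy f).toReal := by
  obtain ⟨ρ, hρ1, hρ⟩ := H.exists_r_le
  have hsqrt : √ρ < 1 := by rwa [Real.sqrt_lt' one_pos, one_pow]
  obtain ⟨K, hK0, hK⟩ := H.exists_abs_sub_ψ_boundary_le
  -- The sum `K + K * √ρ + K * √ρ ^ 2 + ⋯` bounds the oscillation along nested cells.
  obtain ⟨L, hL0, hL⟩ : ∃ L, 0 ≤ L ∧ L * √ρ + K = L := by
    have hpos : 0 < 1 - √ρ := sub_pos.2 hsqrt
    exact ⟨K / (1 - √ρ), by positivity, by field_simp; ring⟩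
  refine ⟨L, hL0, fun n => ?_⟩
  induction n with
  | zero =>
    intro w f hf p hp q hq
    change |f p - f q| ≤ _
    obtain ⟨i, p, hp', rfl⟩ := S.exists_ψ_eq_of_mem_boundary hp
    refine (hK f hf i p hp' q hq).trans (mul_le_mul_of_nonneg_right ?_ (Real.sqrt_nonneg _))
    linarith [mul_nonneg hL0 (Real.sqrt_nonneg ρ)]
  | succ n ih =>
    intro w f hf p hp q hq
    have htail := ih (Fin.tail w) _ (H.comp_cellMap_mem_domain (w 0) hf) p hp q hq
    calc |f (S.wordMap w p) - f q|
        ≤ |f (S.wordMap w p) - f (S.ψ (w 0) q)| + |f (S.ψ (w 0) q) - f q| := abs_sub_le _ _ _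
      _ ≤ L * (√ρ * √(H.energy f).toReal) + K * √(H.energy f).toReal :=
          add_le_add (htail.trans <| mul_le_mul_of_nonneg_left
            (H.sqrt_energy_comp_cellMap_le (hρ _) hf) hL0) (hK f hf (w 0) q hq q hq)
      _ = L * √(H.energy f).toReal := by rw [← mul_assoc, ← add_mul, hL]

theorem exists_sq_sub_le_mul_energy : ∃ K, 0 ≤ K ∧ ∀ f ∈ H.domain, ∀ x y,
    (f x - f y) ^ 2 ≤ K * (H.energy f).toReal := by
  obtain ⟨q, hq⟩ := S.boundary_nonempty
  obtain ⟨K, -, hK⟩ := H.exists_abs_sub_wordMap_le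
  have hcenter (f : C(F, ℝ)) (hf : f ∈ H.domain) (x : F) :
      |f x - f q| ≤ K * √(H.energy f).toReal := by
    obtain ⟨ω, rfl⟩ := S.proj_surjective x
    have hlim := (f.continuous.tendsto _).comp (S.tendsto_wordMap_wordPrefix ω q)
    exact le_of_tendsto' (hlim.sub_const (f q)).abs fun n => hK n _ f hf q hq q hq
  refine ⟨(K + K) ^ 2, by positivity, fun f hf x y => ?_⟩
  calc (f x - f y) ^ 2 = |f x - f y| ^ 2 := (sq_abs _).symm
    _ ≤ (|f x - f q| + |f y - f q|) ^ 2 := by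
        gcongr
        simpa only [abs_sub_comm (f y)] using abs_sub_le (f x) (f q) (f y)
    _ ≤ (K * √(H.energy f).toReal + K * √(H.energy f).toReal) ^ 2 := by
        gcongr <;> exact hcenter f hf _
    _ = (K + K) ^ 2 * (H.energy f).toReal := by
        rw [← add_mul, mul_pow, Real.sq_sqrt ENNReal.toReal_nonneg]

end RegularHarmonicStructure

end Energy

namespace RegularHarmonicStructure

variable {M : ℕ} {F : Type*} [MetricSpace F] [CompactSpace F] [Nonempty F] {S : PCFSet M F}
  (H : RegularHarmonicStructure S)

/-- The effective conductance between `x` and `y`: the least energy of a potential equal to `0` at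
`x` and to `1` at `y`. It is the inverse of `H.R x y`, and `∞` for `x = y`. -/
noncomputable def conductance (x y : F) : ℝ≥0∞ :=
  ⨅ f ∈ {f : C(F, ℝ) | f ∈ H.domain ∧ f x = 0 ∧ f y = 1}, H.energy f

theorem R_eq_toReal_inv_conductance (x y : F) : H.R x y = (H.conductance x y)⁻¹.toReal := rfl

theorem conductance_mul_sq_sub_le_energy {f : C(F, ℝ)} (hf : f ∈ H.domain) (x y : F) :
    H.conductance x y * ENNReal.ofReal ((f x - f y) ^ 2) ≤ H.energy f := by
  obtain hxy | hxy := eq_or_ne (f x) (f y)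
  · simp [hxy]
  have hne : f y - f x ≠ 0 := sub_ne_zero.2 hxy.symm
  set a := (f y - f x)⁻¹
  have henergy := H.energy_affine f a (-(a * f x))
  have hg : H.conductance x y ≤ H.energy (a • f + .const F (-(a * f x))) := by
    refine iInf₂_le _ ⟨henergy.trans_lt (ENNReal.mul_lt_top ENNReal.ofReal_lt_top hf), ?_, ?_⟩
    · simp
    · simp [← sub_eq_add_neg, ← mul_sub, a, hne]
  calc H.conductance x y * ENNReal.ofReal ((f x - f y) ^ 2)
      ≤ ENNReal.ofReal (a ^ 2) * H.energy f * ENNReal.ofReal ((f x - f y) ^ 2) := by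
        rw [← henergy]
        gcongr
    _ = ENNReal.ofReal (a ^ 2 * (f x - f y) ^ 2) * H.energy f := by
        rw [mul_right_comm, ENNReal.ofReal_mul (sq_nonneg a)]
    _ = H.energy f := by
        rw [← neg_sub (f y) (f x), neg_sq, ← mul_pow, inv_mul_cancel₀ hne, one_pow,
          ENNReal.ofReal_one, one_mul]

theorem inv_conductance_le {x y : F} {a : ℝ} (ha : 0 ≤ a)
    (h : ∀ f ∈ H.domain, f x = 0 → f y = 1 → 1 ≤ a * (H.energy f).toReal) :
    (H.conductance x y)⁻¹ ≤ ENNReal.ofReal a := by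
  rw [ENNReal.inv_le_iff_inv_le]
  refine le_iInf₂ fun f ⟨hf, hfx, hfy⟩ => ?_
  have hone := h f hf hfx hfy
  have ha' : 0 < a := ha.lt_of_ne (by rintro rfl; norm_num at hone)
  rw [← ENNReal.ofReal_inv_of_pos ha', ← ENNReal.ofReal_toReal (LT.lt.ne hf)]
  exact ENNReal.ofReal_le_ofReal ((inv_le_iff_one_le_mul₀' ha').2 hone)

theorem R_le {x y : F} {a : ℝ} (ha : 0 ≤ a)
    (h : ∀ f ∈ H.domain, f x = 0 → f y = 1 → 1 ≤ a * (H.energy f).toReal) : H.R x y ≤ a :=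
  ENNReal.toReal_le_of_le_ofReal ha (H.inv_conductance_le ha h)

theorem R_nonneg (x y : F) : 0 ≤ H.R x y := ENNReal.toReal_nonneg

theorem R_self (x : F) : H.R x x = 0 :=
  (H.R_le le_rfl fun _ _ h0 h1 => absurd (h0.symm.trans h1) zero_ne_one).antisymm (H.R_nonneg x x)

variable [PreconnectedSpace F]

theorem exists_inv_conductance_le : ∃ K, 0 ≤ K ∧ ∀ x y,
    (H.conductance x y)⁻¹ ≤ ENNReal.ofReal K := by
  obtain ⟨K, hK0, hK⟩ := H.exists_sq_sub_le_mul_energy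
  refine ⟨K, hK0, fun x y => H.inv_conductance_le hK0 fun f hf hx hy => ?_⟩
  simpa [hx, hy] using hK f hf x y

theorem conductance_ne_zero (x y : F) : H.conductance x y ≠ 0 := by
  obtain ⟨K, -, hK⟩ := H.exists_inv_conductance_le
  exact ENNReal.inv_ne_top.1 (ne_top_of_le_ne_top ENNReal.ofReal_ne_top (hK x y))

theorem exists_R_le : ∃ K, ∀ x y, H.R x y ≤ K := by
  obtain ⟨K, hK0, hK⟩ := H.exists_inv_conductance_le
  exact ⟨K, fun x y => ENNReal.toReal_le_of_le_ofReal hK0 (hK x y)⟩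

theorem sq_sub_le_R_mul_energy {f : C(F, ℝ)} (hf : f ∈ H.domain) (x y : F) :
    (f x - f y) ^ 2 ≤ H.R x y * (H.energy f).toReal := by
  have hinv : (H.conductance x y)⁻¹ ≠ ∞ := ENNReal.inv_ne_top.2 (H.conductance_ne_zero x y)
  have h : ENNReal.ofReal ((f x - f y) ^ 2) ≤ (H.conductance x y)⁻¹ * H.energy f := by
    rw [mul_comm, ← div_eq_mul_inv, ENNReal.le_div_iff_mul_le
      (.inl (H.conductance_ne_zero x y)) (.inr (LT.lt.ne hf)), mul_comm]
    exact H.conductance_mul_sq_sub_le_energy hf x y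
  rw [R_eq_toReal_inv_conductance, ← ENNReal.toReal_mul]
  exact (ENNReal.ofReal_le_iff_le_toReal (ENNReal.mul_ne_top hinv (LT.lt.ne hf))).1 h

theorem R_symm_le (x y : F) : H.R x y ≤ H.R y x :=
  H.R_le (H.R_nonneg y x) fun f hf hx hy => by
    simpa [hx, hy] using H.sq_sub_le_R_mul_energy hf y x

theorem sqrt_R_triangle (x y z : F) : √(H.R x z) ≤ √(H.R x y) + √(H.R y z) := by
  refine (Real.sqrt_le_left (by positivity)).2 (H.R_le (by positivity) fun f hf hx hz => ?_)
  have hosc (a b : F) : |f a - f b| ≤ √(H.R a b) * √(H.energy f).toReal := by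
    rw [← Real.sqrt_mul (H.R_nonneg a b)]
    exact Real.abs_le_sqrt (H.sq_sub_le_R_mul_energy hf a b)
  have hone : 1 ≤ (√(H.R x y) + √(H.R y z)) * √(H.energy f).toReal := by
    calc (1 : ℝ) = |f x - f z| := by simp [hx, hz]
      _ ≤ |f x - f y| + |f y - f z| := abs_sub_le _ _ _
      _ ≤ _ := by rw [add_mul]; exact add_le_add (hosc x y) (hosc y z)
  calc (1 : ℝ) ≤ ((√(H.R x y) + √(H.R y z)) * √(H.energy f).toReal) ^ 2 := one_le_pow₀ hone
    _ = _ := by rw [mul_pow, Real.sq_sqrt ENNReal.toReal_nonneg]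

theorem isSqPseudoMetric_R : IsSqPseudoMetric H.R where
  nonneg := H.R_nonneg
  self := H.R_self
  symm x y := (H.R_symm_le x y).antisymm (H.R_symm_le y x)
  triangle := H.sqrt_R_triangle

theorem R_ψ_le (i : Fin M) (x y : F) : H.R (S.ψ i x) (S.ψ i y) ≤ H.r i * H.R x y := by
  refine H.R_le (mul_nonneg (H.r_pos i).le (H.R_nonneg x y)) fun f hf hx hy => ?_
  have hx' : f.comp (S.cellMap i) x = 0 := hx
  have hy' : f.comp (S.cellMap i) y = 1 := hy
  calc (1 : ℝ) = (f.comp (S.cellMap i) x - f.comp (S.cellMap i) y) ^ 2 := by simp [hx', hy']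
    _ ≤ H.R x y * (H.energy (f.comp (S.cellMap i))).toReal :=
        H.sq_sub_le_R_mul_energy (H.comp_cellMap_mem_domain i hf) x y
    _ ≤ H.R x y * (H.r i * (H.energy f).toReal) :=
        mul_le_mul_of_nonneg_left (H.toReal_energy_comp_cellMap_le i hf) (H.R_nonneg x y)
    _ = H.r i * H.R x y * (H.energy f).toReal := by ring

theorem hasCoveringExponent_R : HasCoveringExponent H.R H.dimH :=
  hasCoveringExponent_of_selfSimilar S.exists_ψ_eq H.r_pos H.r_lt_one H.dimH_spec.1.le
    H.dimH_spec.2.le H.R_ψ_le H.exists_R_le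

end RegularHarmonicStructure

end PCF

theorem mainTheorem7_general
    {X Y : Type*} {d : X → X → ℝ} {e : Y → Y → ℝ} (hd : PCF.IsSqPseudoMetric d)
    (he : PCF.IsSqPseudoMetric e) {κ μ : ℝ} (hκ : 0 ≤ κ) (hμ : 0 ≤ μ)
    (hcov_d : PCF.HasCoveringExponent d μ) (hcov_e : PCF.HasCoveringExponent e κ)
    {E : Type*} [MetricSpace E] [CompleteSpace E] [TopologicalSpace.SeparableSpace E]
    [MeasurableSpace E] [BorelSpace E] {Ω : Type*} [MeasurableSpace Ω] (P : Measure Ω)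
    (ξ : X → Y → Ω → E) (hξ : ∀ t x, Measurable (ξ t x))
    (C β γ γ' : ℝ) (hβ : 0 < β) (hγ : 0 < γ) (hγ' : 0 < γ')
    (hspace : ∀ t x y, ∫⁻ ω, edist (ξ t x ω) (ξ t y ω) ^ β ∂P
      ≤ ENNReal.ofReal (C * e x y ^ (κ + μ + γ)))
    (htime : ∀ s t x, ∫⁻ ω, edist (ξ s x ω) (ξ t x ω) ^ β ∂P
      ≤ ENNReal.ofReal (C * d s t ^ (κ + μ + γ'))) :
    ∃ ξ' : X → Y → Ω → E,
      (∀ t x, Measurable (ξ' t x)) ∧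
      (∀ t x, ∀ᵐ ω ∂P, ξ' t x ω = ξ t x ω) ∧
      (∀ᵐ ω ∂P, PCF.EssentiallyHolder (fun p q : X × Y => max (d p.1 q.1) (e p.2 q.2))
        (min γ γ' / β) (fun p => ξ' p.1 p.2 ω)) ∧
      (∀ t, ∀ᵐ ω ∂P, PCF.EssentiallyHolder e ((μ + γ) / β) (fun x => ξ' t x ω)) ∧
      (∀ x, ∀ᵐ ω ∂P, PCF.EssentiallyHolder d ((κ + γ') / β) (fun t => ξ' t x ω)) := by
  have : SecondCountableTopology E := UniformSpace.secondCountable_of_separable E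
  have hmin : 0 < min γ γ' := lt_min hγ hγ'
  obtain ⟨Kd, hKd⟩ := hd.exists_le_of_hasCoveringExponent hcov_d
  obtain ⟨Ke, hKe⟩ := he.exists_le_of_hasCoveringExponent hcov_e
  obtain ⟨C', hjoint⟩ := PCF.exists_lintegral_edist_rpow_le_max hd.nonneg he.nonneg
    (fun s t => (hKd s t).trans (le_max_left Kd Ke)) (fun x y => (hKe x y).trans (le_max_right _ _))
    (s := κ + μ + min γ γ') (by linarith) (by gcongr; exact min_le_left _ _)
    (by gcongr; exact min_le_right _ _) hξ hβ.le hspace htime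
  have hcov := hcov_d.prod hcov_e
  rw [add_comm μ κ] at hcov
  obtain ⟨ξ', hmeas, hmod, hholder⟩ := (hd.prod he).exists_essentiallyHolder_modification hcov
    (by linarith) (by linarith) (fun z => hξ z.1 z.2) hβ hjoint
  rw [add_sub_cancel_left] at hholder
  refine ⟨fun t x => ξ' (t, x), fun t x => hmeas (t, x), fun t x => hmod (t, x), hholder,
    fun t => ?_, fun x => ?_⟩
  · have hcont : ∀ᵐ ω ∂P, PCF.EssentiallyHolder e (min γ γ' / β) fun x => ξ' (t, x) ω :=
      hholder.mono fun ω hω => hω.comp (t, ·) fun x y => by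
        simp only [hd.self, max_eq_right (he.nonneg x y)]
    have h := he.essentiallyHolder_of_modification hcov_e hκ (by linarith) (hξ t) hβ (hspace t)
      (fun x => hmod (t, x)) hcont
    rwa [add_assoc, add_sub_cancel_left] at h
  · have hcont : ∀ᵐ ω ∂P, PCF.EssentiallyHolder d (min γ γ' / β) fun t => ξ' (t, x) ω :=
      hholder.mono fun ω hω => hω.comp (·, x) fun s t => by
        simp only [he.self, max_eq_left (hd.nonneg s t)]
    have h := hd.essentiallyHolder_of_modification hcov_d hμ (by linarith) (hξ · x) hβ
      (htime · · x) (fun t => hmod (t, x)) hcont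
    rwa [add_right_comm, add_sub_cancel_right] at h

theorem mainTheorem7
    {M : ℕ} {F : Type*} [MetricSpace F] [CompactSpace F] [ConnectedSpace F]
    (S : PCF.PCFSet M F) (H : PCF.RegularHarmonicStructure S)
    {E : Type*} [MetricSpace E] [CompleteSpace E] [TopologicalSpace.SeparableSpace E]
    [MeasurableSpace E] [BorelSpace E]
    {Ω : Type*} [MeasurableSpace Ω] (P : Measure Ω) [IsProbabilityMeasure P]
    (T : ℝ) (hT : 0 < T)
    (ξ : Set.Icc (0 : ℝ) T → F → Ω → E) (hξ : ∀ t x, Measurable (ξ t x))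
    (C β γ γ' : ℝ) (hC : 0 < C) (hβ : 0 < β) (hγ : 0 < γ) (hγ' : 0 < γ')
    (hspace : ∀ t x y, ∫⁻ ω, edist (ξ t x ω) (ξ t y ω) ^ β ∂P
      ≤ ENNReal.ofReal (C * H.R x y ^ (H.dimH + 1 + γ)))
    (htime : ∀ s t x, ∫⁻ ω, edist (ξ s x ω) (ξ t x ω) ^ β ∂P
      ≤ ENNReal.ofReal (C * |(s : ℝ) - (t : ℝ)| ^ (H.dimH + 1 + γ'))) :
    ∃ ξ' : Set.Icc (0 : ℝ) T → F → Ω → E,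
      (∀ t x, Measurable (ξ' t x)) ∧
      (∀ t x, ∀ᵐ ω ∂P, ξ' t x ω = ξ t x ω) ∧
      (∀ᵐ ω ∂P, PCF.EssentiallyHolder (H.Rinf T) (min γ γ' / β)
        (fun p : Set.Icc (0 : ℝ) T × F => ξ' p.1 p.2 ω)) ∧
      (∀ t, ∀ᵐ ω ∂P, PCF.EssentiallyHolder H.R ((1 + γ) / β) (fun x => ξ' t x ω)) ∧
      (∀ x, ∀ᵐ ω ∂P, PCF.EssentiallyHolder
        (fun s t : Set.Icc (0 : ℝ) T => |(s : ℝ) - (t : ℝ)|) ((H.dimH + γ') / β)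
        (fun t => ξ' t x ω)) :=
  mainTheorem7_general (.abs_sub _) H.isSqPseudoMetric_R H.dimH_spec.1.le zero_le_one
    (PCF.hasCoveringExponent_Icc hT.le) H.hasCoveringExponent_R P ξ hξ C β γ γ' hβ hγ hγ' hspace
    htime
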